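/- Fix $c>0$. Let $f(Q,M)=(Q^2-1)^2+\tfrac14(M^2-1)^2-cQM^2$ on $\mathbb R^2$, let $\beta(c)=\min f$ and $\tilde f=f-\beta(c)\ge 0$. Put $$\rho^*=\Big(\tfrac c8+\sqrt{\tfrac{c^2}{64}-\tfrac1{27}\big(1+\tfrac{c^2}2\big)^3}\Big)^{1/3}+\Big(\tfrac c8-\sqrt{\tfrac{c^2}{64}-\tfrac1{27}\big(1+\tfrac{c^2}2\big)^3}\Big)^{1/3}$$ (principal complex roots; the sum is real), $\mathbf p^*=(\rho^*,\sqrt{1+2c\rho^*})$, $\mathbf p^{**}=(\rho^*,-\sqrt{1+2c\rho^*})$, $\mathbf p_b(-1)=(1,1)$, $\mathbf p_b(1)=(-1,-1)$. For $l>0$ consider the rescaled order reconstruction (OR) energy $$E_l(Q_{11},M_1)=\int_{-1}^{1}\Big\{\tfrac{\sqrt l}{2}\Big(\tfrac{dQ_{11}}{dy}\Big)^2+\tfrac{\sqrt l}{2}\Big(\tfrac{dM_1}{dy}\Big)^2+\tfrac1{\sqrt l}\tilde f(Q_{11},M_1)\Big\}\,dy$$ on the maps $\mathbf p=(Q_{11},M_1)\in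 W^{1,2}((-1,1);\mathbb R^2)$ with $\mathbf p(\pm1)=\mathbf p_b(\pm1)$. For $\mathbf a,\mathbf b\in\mathbb R^2$ let $$d(\mathbf a,\mathbf b)=\inf\Big\{\int_{-1}^1\tilde f^{1/2}(\mathbf p(t))\,|\mathbf p'(t)|\,dt:\ \mathbf p\in C^1([-1,1];\mathbb R^2),\ \mathbf p(-1)=\mathbf a,\ \mathbf p(1)=\mathbf b\Big\}.$$ Let $l_n>0$ with $l_n\to0$, and let $\mathbf p_{l_n}$ be a minimiser of $E_{l_n}$ for every $n$. Then there is a subsequence $(l_{n_k})$ such that $\mathbf p_{l_{n_k}}$ converges in $L^1([-1,1])$ and almost everywhere to a map $$\mathbf p_0=\sum_{j=0}^{N}\mathbf p^{i_j}\chi_{E_j},\qquad i_j\in\{*,**\},$$ where $N\ge0$, the $E_j\subset(-1,1)$ are consecutive disjoint non-degenerate intervals with $\bigcup_{j=0}^N E_j=(-1,1)$, and $i_j\ne i_{j+1}$, so that $N$ is the number of jumps between $\mathbf p^*$ and $\mathbf p^{**}$. Moreover, $(E_j,i_j)_{0\le j\le N}$ minimises, among all such configurations (with any number of jumps), $$J=\sum_{j=1}^{N}d(\mathbf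 p^*,\mathbf p^{**})+d\big(\mathbf p_0(-1),\mathbf p_b(-1)\big)+d\big(\mathbf p_0(1),\mathbf p_b(1)\big),$$ where $\mathbf p_0(-1)=\mathbf p^{i_0}$ and $\mathbf p_0(1)=\mathbf p^{i_N}$ are the values of $\mathbf p_0$ next to the end points. -/

import Mathlib

open Set Filter Topology MeasureTheory
open scoped ContDiff

noncomputable section

namespace Ferronematic

/-- The plane of pairs `p = (Q₁₁, M₁)` with its Euclidean norm; `p 0 = Q₁₁`, `p 1 = M₁`. -/
abbrev Plane : Type := EuclideanSpace ℝ (Fin 2)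

/-! ### The bulk potential and its minimisers -/

/-- The order reconstruction bulk potential
`f(Q, M) = (Q² - 1)² + (M² - 1)² / 4 - c Q M²`. -/
def bulk (c : ℝ) (p : Plane) : ℝ :=
  (p 0 ^ 2 - 1) ^ 2 + 1 / 4 * (p 1 ^ 2 - 1) ^ 2 - c * p 0 * p 1 ^ 2

/-- The minimum value `β(c)` of the bulk potential. -/
def bulkMin (c : ℝ) : ℝ := ⨅ p : Plane, bulk c p

/-- The non-negative bulk potential `f - β(c)`. -/
def bulkNonneg (c : ℝ) (p : Plane) : ℝ := bulk c p - bulkMin c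

/-- The complex square root `√(c²/64 - (1 + c²/2)³/27)` in Cardano's formula
(the radicand is a negative real number). -/
def cardanoRoot (c : ℝ) : ℂ :=
  ((c ^ 2 / 64 - 1 / 27 * (1 + c ^ 2 / 2) ^ 3 : ℝ) : ℂ) ^ (1 / 2 : ℂ)

/-- `ρ*`, the sum of the two complex conjugate principal cube roots
`(c/8 ± √(c²/64 - (1 + c²/2)³/27))^(1/3)`; the sum is real, `re` only changes its type. -/
def rhoStar (c : ℝ) : ℝ :=
  (((c : ℂ) / 8 + cardanoRoot c) ^ (1 / 3 : ℂ) +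
    ((c : ℂ) / 8 - cardanoRoot c) ^ (1 / 3 : ℂ)).re

/-- `p* = (ρ*, √(1 + 2cρ*))`. -/
def pStar (c : ℝ) : Plane := !₂[rhoStar c, Real.sqrt (1 + 2 * c * rhoStar c)]

/-- `p** = (ρ*, -√(1 + 2cρ*))`. -/
def pStarStar (c : ℝ) : Plane := !₂[rhoStar c, -Real.sqrt (1 + 2 * c * rhoStar c)]

/-- The boundary value at `y = -1`. -/
def pbLeft : Plane := !₂[1, 1]

/-- The boundary value at `y = 1`. -/
def pbRight : Plane := !₂[-1, -1]

/-! ### The admissible space and the rescaled energy -/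

/-- `g` is a weak derivative of `u` on `(-1, 1)`. -/
def IsWeakDeriv (u g : ℝ → Plane) : Prop :=
  ∀ φ : ℝ → ℝ, ContDiff ℝ ∞ φ → HasCompactSupport φ → tsupport φ ⊆ Ioo (-1) 1 →
    ∫ y in Ioo (-1 : ℝ) 1, deriv φ y • u y = -∫ y in Ioo (-1 : ℝ) 1, φ y • g y

/-- An admissible map: an element of `W^{1,2}((-1, 1); ℝ²)`, given by its continuous
representative on `[-1, 1]` together with its weak derivative (which is unique up to null sets),
subject to the Dirichlet conditions at `y = ± 1`. -/
structure AdmissibleMap where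
  /-- The continuous representative of the map. -/
  toFun : ℝ → Plane
  /-- Its weak derivative. -/
  wderiv : ℝ → Plane
  continuousOn : ContinuousOn toFun (Icc (-1) 1)
  memLp : MemLp toFun 2 (volume.restrict (Ioo (-1) 1))
  memLp_wderiv : MemLp wderiv 2 (volume.restrict (Ioo (-1) 1))
  isWeakDeriv : IsWeakDeriv toFun wderiv
  left_eq : toFun (-1) = pbLeft
  right_eq : toFun 1 = pbRight

/-- The rescaled order reconstruction energy
`∫_{-1}^{1} (√l/2) (Q₁₁')² + (√l/2) (M₁')² + (1/√l) (f(Q₁₁, M₁) - β(c)) dy`. -/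
def energy (c l : ℝ) (p : AdmissibleMap) : ℝ :=
  ∫ y in Ioo (-1 : ℝ) 1,
    (Real.sqrt l / 2 * p.wderiv y 0 ^ 2 + Real.sqrt l / 2 * p.wderiv y 1 ^ 2 +
      1 / Real.sqrt l * bulkNonneg c (p.toFun y))

/-- `p` is a (global) minimiser of the rescaled energy in the admissible space. -/
def IsMinimiser (c l : ℝ) (p : AdmissibleMap) : Prop :=
  ∀ q : AdmissibleMap, energy c l p ≤ energy c l q

/-! ### The degenerate metric -/

/-- The weighted length `∫_{-1}^{1} √(f - β(c))(γ(t)) |γ'(t)| dt` of a curve. -/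
def weightedLength (c : ℝ) (γ : ℝ → Plane) : ℝ :=
  ∫ t in Ioo (-1 : ℝ) 1,
    Real.sqrt (bulkNonneg c (γ t)) * ‖derivWithin γ (Icc (-1) 1) t‖

/-- The degenerate geodesic metric: the infimum of the weighted lengths of the `C¹` curves
`[-1, 1] → ℝ²` from `a` to `b`. -/
def geoDist (c : ℝ) (a b : Plane) : ℝ :=
  sInf {L : ℝ | ∃ γ : ℝ → Plane, ContDiffOn ℝ 1 γ (Icc (-1) 1) ∧ γ (-1) = a ∧ γ 1 = b ∧
    L = weightedLength c γ}

/-! ### Piecewise constant limit maps and the limit functional -/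

/-- A partition of `(-1, 1)` into finitely many consecutive intervals `E_0, …, E_n`, together with
a choice of `p*` or `p**` on each of them, neighbouring intervals carrying different values (so
that the `n` interior break points are exactly the jumps between `p*` and `p**`). -/
structure TwoPhasePartition (c : ℝ) where
  /-- The number of jumps. -/
  jumps : ℕ
  /-- The break points `-1 = t_0 < t_1 < ⋯ < t_{n+1} = 1`. -/
  pt : Fin (jumps + 2) → ℝ
  pt_strictMono : StrictMono pt
  pt_zero : pt 0 = -1
  pt_last : pt (Fin.last (jumps + 1)) = 1
  /-- The value on the `j`-th interval. -/
  value : Fin (jumps + 1) → Plane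
  value_mem : ∀ j, value j = pStar c ∨ value j = pStarStar c
  value_ne : ∀ j : Fin jumps, value j.castSucc ≠ value j.succ

namespace TwoPhasePartition

variable {c : ℝ}

/-- The `j`-th interval `E_j = [t_j, t_{j+1}) ∩ (-1, 1)`; these are disjoint with
union `(-1, 1)`. -/
def interval (P : TwoPhasePartition c) (j : Fin (P.jumps + 1)) : Set ℝ :=
  Ico (P.pt j.castSucc) (P.pt j.succ) ∩ Ioo (-1) 1

/-- The piecewise constant map `p₀ = ∑_j p^{i_j} χ_{E_j}`. -/
def map (P : TwoPhasePartition c) (y : ℝ) : Plane :=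
  ∑ j, (P.interval j).indicator (fun _ => P.value j) y

/-- The functional `J`: the cost `d(p*, p**)` for each jump, plus the boundary layer costs
`d(p₀(-1), p_b(-1))` and `d(p₀(1), p_b(1))`, where `p₀(-1)` and `p₀(1)` are the values of `p₀`
next to the end points. -/
def J (P : TwoPhasePartition c) : ℝ :=
  ∑ _j : Fin P.jumps, geoDist c (pStar c) (pStarStar c) +
    geoDist c (P.value 0) pbLeft + geoDist c (P.value (Fin.last P.jumps)) pbRight

end TwoPhasePartition

end Ferronematic

end

noncomputable section

namespace Ferronematic

/-! ### Cardano's formula and the bulk potential -/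

/-! The argument is of Modica–Mortola type. By the inequality of arithmetic and geometric means the
energy is at least `√2` times the weighted length of the map, hence at least `√2` times the sum of
the distances `geoDist` between its successive values
(`AdmissibleMap.sqrt_two_mul_geoDist_le_energy`). Conversely, for each of the two zeros `w` of
`bulkNonneg`, gluing two nearly optimal boundary layers to the constant `w` gives energy at most `√2
(d(p_b(-1), w) + d(w, p_b(1))) + ε` for small `l` (`exists_forall_exists_energy_le`).

Competitors with interior jumps are not needed: by the triangle inequality any configuration costs
at least as much as the constant one with its first value (`boundaryCost_value_le_J`).

No compactness theorem for functions of bounded variation is needed either. The energies are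
bounded, so the potential of the minimisers tends to zero in `L¹`, and almost everywhere along a
subsequence. At such points the sign of the second coordinate tells which zero is near. A pattern
`w, w', w` of the two zeros at three points, recurring infinitely often, would force two crossings
of positive cost `d(p*, p**)` on top of the boundary cost of `w`, against the upper bound. Thus
after extraction on a countable dense set of points the index switches at most once, and the same
exclusion carries convergence over to almost every point. The growth bound
`exists_norm_le_bulkNonneg` upgrades this to `L¹`. The lower bound in the limit, compared with the
constant competitors, gives minimality of `J`. -/

theorem rhoStar_pos_and_cubic {c : ℝ} (hc : 0 < c) :
    0 < rhoStar c ∧ rhoStar c ^ 3 = (1 + c ^ 2 / 2) * rhoStar c + c / 4 := by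
  set D : ℝ := (1 + c ^ 2 / 2) ^ 3 / 27 - c ^ 2 / 64 with hD
  have hDpos : 0 < D := by
    have : 0 < c ^ 2 := by positivity
    have h4 : 0 < c ^ 4 := by positivity
    have h6 : 0 < c ^ 6 := by positivity
    have : D = (1 + 3 / 2 * c ^ 2 + 3 / 4 * c ^ 4 + c ^ 6 / 8) / 27 - c ^ 2 / 64 := by
      rw [hD]; ring
    rw [this]; nlinarith
  set r := cardanoRoot c with hr
  have hr2 : r ^ 2 = ((-D : ℝ) : ℂ) := by
    have h := Complex.cpow_nat_inv_pow ((-D : ℝ) : ℂ) (n := 2) two_ne_zero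
    rw [hr, cardanoRoot, ← h]
    congr 2
    · congr 1; rw [hD]; ring
    · norm_num
  have hre := congrArg Complex.re hr2
  have him := congrArg Complex.im hr2
  simp only [pow_two, Complex.mul_re, Complex.mul_im, Complex.ofReal_re, Complex.ofReal_im] at hre him
  -- The radicand is `-D < 0`, so its root `r` is purely imaginary. The two numbers under the cube
  -- roots are therefore conjugates `z` and `conj z` with positive real part, and the principal cube
  -- root commutes with conjugation away from the negative axis.
  have hr0 : r.re = 0 := by
    have h : r.re * r.im = 0 := by linarith
    rcases mul_eq_zero.1 h with h | h
    · exact h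
    · rw [h] at hre
      nlinarith [mul_self_nonneg r.re]
  have himsq : r.im * r.im = D := by rw [hr0] at hre; linarith
  set z : ℂ := (c : ℂ) / 8 + r with hz
  have hzre : z.re = c / 8 := by
    have : ((c : ℂ) / 8) = ((c / 8 : ℝ) : ℂ) := by push_cast; ring
    rw [hz, this, Complex.add_re, Complex.ofReal_re, hr0, add_zero]
  have hzim : z.im = r.im := by
    have : ((c : ℂ) / 8) = ((c / 8 : ℝ) : ℂ) := by push_cast; ring
    rw [hz, this, Complex.add_im, Complex.ofReal_im, zero_add]
  have hconj : (c : ℂ) / 8 - r = (starRingEnd ℂ) z := by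
    have : ((c : ℂ) / 8) = ((c / 8 : ℝ) : ℂ) := by push_cast; ring
    apply Complex.ext
    · rw [Complex.conj_re, hzre, this, Complex.sub_re, Complex.ofReal_re, hr0, sub_zero]
    · rw [Complex.conj_im, hzim, this, Complex.sub_im, Complex.ofReal_im, zero_sub]
  have hz0 : z ≠ 0 := by
    intro h; rw [h] at hzre; simp at hzre; linarith
  have harg : |z.arg| < Real.pi / 2 :=
    Complex.abs_arg_lt_pi_div_two_iff.2 (Or.inl (by rw [hzre]; positivity))
  have hargpi : z.arg ≠ Real.pi := by
    intro h; rw [h, abs_of_pos Real.pi_pos] at harg; linarith [Real.pi_pos]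
  set w : ℂ := z ^ (1 / 3 : ℂ) with hw
  have hw3 : w ^ 3 = z := by
    have h := Complex.cpow_nat_inv_pow z (n := 3) (by norm_num)
    rw [hw, show (1 / 3 : ℂ) = ((3 : ℕ) : ℂ)⁻¹ by norm_num]; exact h
  have hwc : (starRingEnd ℂ) z ^ (1 / 3 : ℂ) = (starRingEnd ℂ) w := by
    rw [Complex.conj_cpow _ _ hargpi, hw]
    rw [show (1 / 3 : ℂ) = ((1 / 3 : ℝ) : ℂ) by push_cast; ring, Complex.conj_ofReal]
  have hrho : rhoStar c = 2 * w.re := by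
    rw [rhoStar, ← hr, hconj, ← hz, hwc, Complex.add_re, Complex.conj_re]; ring
  have hwre : 0 < w.re := by
    rw [hw, Complex.cpow_def_of_ne_zero hz0, Complex.exp_re]
    apply mul_pos (Real.exp_pos _)
    have : (Complex.log z * (1 / 3 : ℂ)).im = z.arg / 3 := by
      have : (1 / 3 : ℂ) = ((1 / 3 : ℝ) : ℂ) := by push_cast; ring
      rw [this, Complex.im_mul_ofReal, Complex.log_im]; ring
    rw [this]
    have := abs_lt.1 harg
    apply Real.cos_pos_of_mem_Ioo
    constructor <;> linarith [Real.pi_pos]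
  refine ⟨by rw [hrho]; linarith, ?_⟩
  -- `|w|⁶ = |z|² = c²/64 + D` is a perfect cube. With `|w|²` known, the cubic for `2 Re w` is the
  -- triple angle identity `8a³ = 2 Re(w³) + 6a|w|²`, where `a = Re w`.
  have hns : Complex.normSq w ^ 3 = ((1 + c ^ 2 / 2) / 3) ^ 3 := by
    rw [← map_pow, hw3, Complex.normSq_apply, hzre, hzim, himsq, hD]; ring
  have hs : Complex.normSq w = (1 + c ^ 2 / 2) / 3 :=
    (Odd.strictMono_pow (by decide : Odd 3)).injective hns
  have h3 := congrArg Complex.re hw3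
  rw [hzre] at h3
  rw [Complex.normSq_apply] at hs
  simp only [pow_succ, pow_zero, one_mul, Complex.mul_re, Complex.mul_im] at h3
  rw [hrho]
  linear_combination 2 * h3 + 6 * w.re * hs

theorem rhoStar_pos {c : ℝ} (hc : 0 < c) : 0 < rhoStar c := (rhoStar_pos_and_cubic hc).1

theorem rhoStar_cubic {c : ℝ} (hc : 0 < c) :
    rhoStar c ^ 3 = (1 + c ^ 2 / 2) * rhoStar c + c / 4 := (rhoStar_pos_and_cubic hc).2

/-- The second coordinate of `p*`. -/
def mStar (c : ℝ) : ℝ := Real.sqrt (1 + 2 * c * rhoStar c)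

theorem mStar_sq {c : ℝ} (hc : 0 < c) : mStar c ^ 2 = 1 + 2 * c * rhoStar c :=
  Real.sq_sqrt (by have := rhoStar_pos hc; positivity)

theorem mStar_pos {c : ℝ} (hc : 0 < c) : 0 < mStar c :=
  Real.sqrt_pos.2 (by have := rhoStar_pos hc; positivity)

@[simp] theorem pStar_zero (c : ℝ) : pStar c 0 = rhoStar c := rfl
@[simp] theorem pStar_one (c : ℝ) : pStar c 1 = mStar c := rfl
@[simp] theorem pStarStar_zero (c : ℝ) : pStarStar c 0 = rhoStar c := rfl
@[simp] theorem pStarStar_one (c : ℝ) : pStarStar c 1 = -mStar c := rfl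

/-- Completing the square in `M²` leaves the quartic `(Q² - 1)² - cQ - c²Q²`. Its derivative
vanishes at `ρ*` exactly by the cubic equation, so `(Q - ρ*)²` splits off. The cofactor is `(Q +
ρ*)² + 2ρ*² - 2 - c²`, whose constant part equals the positive number `c / (2ρ*)`, again by the
cubic. Both summands are then non-negative, which identifies the global minimum. -/
theorem bulk_eq {c : ℝ} (hc : 0 < c) (p : Plane) :
    bulk c p = (p 0 - rhoStar c) ^ 2 * ((p 0 + rhoStar c) ^ 2 + c / (2 * rhoStar c)) +
      1 / 4 * (p 1 ^ 2 - 1 - 2 * c * p 0) ^ 2 + bulk c (pStar c) := by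
  have h0 := rhoStar_pos hc
  have h1 := rhoStar_cubic hc
  have hm := mStar_sq hc
  have hk : c / (2 * rhoStar c) = 2 * (rhoStar c) ^ 2 - 2 - c ^ 2 := by
    field_simp
    linear_combination -4 * h1
  simp only [bulk, pStar_zero, pStar_one, hm, hk]
  linear_combination (4 * p 0 - 4 * rhoStar c) * h1

theorem bulkMin_eq {c : ℝ} (hc : 0 < c) : bulkMin c = bulk c (pStar c) := by
  have h0 := rhoStar_pos hc
  have hle : ∀ p : Plane, bulk c (pStar c) ≤ bulk c p := fun p => by
    rw [bulk_eq hc p]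
    have : 0 ≤ (p 0 - rhoStar c) ^ 2 * ((p 0 + rhoStar c) ^ 2 + c / (2 * rhoStar c)) := by
      positivity
    have : 0 ≤ 1 / 4 * (p 1 ^ 2 - 1 - 2 * c * p 0) ^ 2 := by positivity
    linarith
  exact le_antisymm (ciInf_le ⟨_, by rintro _ ⟨p, rfl⟩; exact hle p⟩ _) (le_ciInf hle)

theorem bulkNonneg_eq {c : ℝ} (hc : 0 < c) (p : Plane) :
    bulkNonneg c p = (p 0 - rhoStar c) ^ 2 * ((p 0 + rhoStar c) ^ 2 + c / (2 * rhoStar c)) +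
      1 / 4 * (p 1 ^ 2 - 1 - 2 * c * p 0) ^ 2 := by
  rw [bulkNonneg, bulkMin_eq hc, bulk_eq hc p]; ring

theorem bulkNonneg_nonneg {c : ℝ} (hc : 0 < c) (p : Plane) : 0 ≤ bulkNonneg c p := by
  have h0 := rhoStar_pos hc
  rw [bulkNonneg_eq hc]; positivity

@[fun_prop] theorem continuous_bulkNonneg (c : ℝ) : Continuous (bulkNonneg c) := by
  unfold bulkNonneg bulk; fun_prop

theorem bulkNonneg_pStar {c : ℝ} (hc : 0 < c) : bulkNonneg c (pStar c) = 0 := by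
  rw [bulkNonneg, bulkMin_eq hc, sub_self]

theorem bulkNonneg_pStarStar {c : ℝ} (hc : 0 < c) : bulkNonneg c (pStarStar c) = 0 := by
  rw [bulkNonneg_eq hc, pStarStar_zero, pStarStar_one, neg_sq, mStar_sq hc]; ring

/-- Quadratic lower bounds for the bulk potential around its zero set. -/
theorem exists_sq_le_bulkNonneg {c : ℝ} (hc : 0 < c) :
    ∃ K : ℝ, 0 < K ∧ ∀ p : Plane, (p 0 - rhoStar c) ^ 2 ≤ K * bulkNonneg c p ∧
      (p 1 ^ 2 - mStar c ^ 2) ^ 2 ≤ K * bulkNonneg c p := by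
  have h0 := rhoStar_pos hc
  set k := c / (2 * rhoStar c) with hk
  have hkpos : 0 < k := by positivity
  -- The first summand serves `a² ≤ F / k`. The others come from `b² ≤ 2(b - 2ca)² + 8c²a²` together
  -- with `(b - 2ca)² ≤ 4F`.
  refine ⟨1 / k + 8 + 8 * c ^ 2 / k, by positivity, fun p => ?_⟩
  have hf := bulkNonneg_eq hc p
  rw [← hk] at hf
  set F := bulkNonneg c p
  set a := p 0 - rhoStar c with ha
  set b := p 1 ^ 2 - mStar c ^ 2 with hb
  have hb' : p 1 ^ 2 - 1 - 2 * c * p 0 = b - 2 * c * a := by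
    rw [hb, mStar_sq hc, ha]; ring
  rw [hb'] at hf
  have hF0 : 0 ≤ F := bulkNonneg_nonneg hc p
  have h1 : a ^ 2 * k ≤ F := by
    have : 0 ≤ a ^ 2 * (p 0 + rhoStar c) ^ 2 := by positivity
    nlinarith [sq_nonneg (b - 2 * c * a)]
  have h2 : (b - 2 * c * a) ^ 2 ≤ 4 * F := by
    have : 0 ≤ a ^ 2 * ((p 0 + rhoStar c) ^ 2 + k) := by positivity
    nlinarith
  have h1' : a ^ 2 ≤ 1 / k * F := by
    rw [div_mul_eq_mul_div, one_mul, le_div_iff₀ hkpos]; exact h1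
  have h3 : b ^ 2 ≤ 8 * F + 8 * c ^ 2 * (1 / k * F) := by
    nlinarith [sq_nonneg (b - 4 * c * a), mul_le_mul_of_nonneg_left h1' (sq_nonneg c)]
  have e : (1 / k + 8 + 8 * c ^ 2 / k) * F = 1 / k * F + (8 * F + 8 * c ^ 2 * (1 / k * F)) := by
    ring
  have hp1 : 0 ≤ 1 / k * F := by positivity
  have hp2 : 0 ≤ 8 * c ^ 2 * (1 / k * F) := by positivity
  rw [e]
  constructor <;> linarith

/-- Coercivity of the potential. Linear growth is enough: it dominates the minimisers by a constant
plus a sequence vanishing in `L¹`. -/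
theorem exists_norm_le_bulkNonneg {c : ℝ} (hc : 0 < c) :
    ∃ K : ℝ, 0 < K ∧ ∀ p : Plane, ‖p‖ ≤ K + K * bulkNonneg c p := by
  obtain ⟨K, hK, h⟩ := exists_sq_le_bulkNonneg hc
  refine ⟨2 * K + 3 + |rhoStar c| + mStar c ^ 2, by positivity, fun p => ?_⟩
  obtain ⟨h1, h2⟩ := h p
  have hF := bulkNonneg_nonneg hc p
  set F := bulkNonneg c p
  have hnorm : ‖p‖ ≤ |p 0| + |p 1| := by
    rw [EuclideanSpace.norm_eq, Fin.sum_univ_two]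
    apply Real.sqrt_le_iff.2
    refine ⟨by positivity, ?_⟩
    simp only [Real.norm_eq_abs]
    nlinarith [abs_nonneg (p 0), abs_nonneg (p 1), mul_nonneg (abs_nonneg (p 0)) (abs_nonneg (p 1))]
  have e1 : |p 0| ≤ |rhoStar c| + 1 + K * F := by
    have : |p 0| ≤ |p 0 - rhoStar c| + |rhoStar c| := by
      simpa using abs_add_le (p 0 - rhoStar c) (rhoStar c)
    nlinarith [sq_abs (p 0 - rhoStar c), sq_nonneg (|p 0 - rhoStar c| - 1),
      abs_nonneg (p 0 - rhoStar c)]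
  have e2 : |p 1| ≤ 2 + mStar c ^ 2 + K * F := by
    have h3 : p 1 ^ 2 ≤ mStar c ^ 2 + 1 + K * F := by
      nlinarith [sq_nonneg (p 1 ^ 2 - mStar c ^ 2 - 1)]
    nlinarith [sq_abs (p 1), sq_nonneg (|p 1| - 1), abs_nonneg (p 1)]
  have e3 : 0 ≤ (3 + |rhoStar c| + mStar c ^ 2) * F := by positivity
  nlinarith

theorem pStar_ne_pStarStar {c : ℝ} (hc : 0 < c) : pStar c ≠ pStarStar c := by
  intro h
  have h1 := congrArg (fun p : Plane => p 1) h
  simp only [pStar_one, pStarStar_one] at h1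
  linarith [mStar_pos hc]

theorem norm_sq_eq (p : Plane) : ‖p‖ ^ 2 = p 0 ^ 2 + p 1 ^ 2 := by
  rw [EuclideanSpace.norm_sq_eq, Fin.sum_univ_two]; simp

theorem norm_sub_sq_eq (p q : Plane) : ‖p - q‖ ^ 2 = (p 0 - q 0) ^ 2 + (p 1 - q 1) ^ 2 := by
  rw [norm_sq_eq]; rfl

/-- Near the zero set, the sign of the second coordinate decides which zero is close. -/
theorem exists_norm_sub_sq_le {c : ℝ} (hc : 0 < c) :
    ∃ K : ℝ, 0 < K ∧ ∀ p : Plane,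
      (0 ≤ p 1 → ‖p - pStar c‖ ^ 2 ≤ K * bulkNonneg c p) ∧
      (p 1 ≤ 0 → ‖p - pStarStar c‖ ^ 2 ≤ K * bulkNonneg c p) := by
  obtain ⟨K, hK, h⟩ := exists_sq_le_bulkNonneg hc
  have hm := mStar_pos hc
  refine ⟨K + K / mStar c ^ 2, by positivity, fun p => ?_⟩
  obtain ⟨h1, h2⟩ := h p
  -- Here `x` stands for `|p 1|`. In `x² - m² = (x - m)(x + m)` the second factor is at least `m >
  -- 0`, so it can be divided out.
  have key : ∀ x : ℝ, 0 ≤ x → x ^ 2 = p 1 ^ 2 →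
      (p 0 - rhoStar c) ^ 2 + (x - mStar c) ^ 2 ≤ (K + K / mStar c ^ 2) * bulkNonneg c p := by
    intro x hx hx2
    have : (x - mStar c) ^ 2 ≤ K / mStar c ^ 2 * bulkNonneg c p := by
      rw [div_mul_eq_mul_div, le_div_iff₀ (by positivity)]
      refine le_trans ?_ h2
      rw [← hx2, show (x ^ 2 - mStar c ^ 2) ^ 2 = (x - mStar c) ^ 2 * (x + mStar c) ^ 2 by ring]
      gcongr
      linarith
    linarith
  constructor
  · intro hp
    rw [norm_sub_sq_eq]
    exact key _ hp rfl
  · intro hp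
    rw [norm_sub_sq_eq]
    have := key (-p 1) (by linarith) (by ring)
    simp only [pStarStar_zero, pStarStar_one]
    nlinarith

/-! ### Absolutely continuous curves and their weighted length -/

/-- `γ` is absolutely continuous on `[a, b]` with derivative `g`. -/
def IsPrimitive (γ g : ℝ → Plane) (a b : ℝ) : Prop :=
  IntervalIntegrable g volume a b ∧ ∀ y ∈ Icc a b, γ y = γ a + ∫ t in a..y, g t

/-- The density `√f̃(γ) |g|` of the weighted length of a curve `γ` with derivative `g`. -/
def lengthDensity (c : ℝ) (γ g : ℝ → Plane) (t : ℝ) : ℝ := Real.sqrt (bulkNonneg c (γ t)) * ‖g t‖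

namespace IsPrimitive

variable {γ g : ℝ → Plane} {a b d : ℝ}

theorem continuousOn (h : IsPrimitive γ g a b) (hab : a ≤ b) : ContinuousOn γ (Icc a b) := by
  have h1 : ContinuousOn (fun y => γ a + ∫ t in a..y, g t) (Icc a b) := by
    refine continuousOn_const.add ?_
    have := intervalIntegral.continuousOn_primitive_interval (a := a) (b := b) (f := g)
      (μ := volume) (by rw [uIcc_of_le hab]; exact (intervalIntegrable_iff_integrableOn_Icc_of_le hab).1 h.1)
    rwa [uIcc_of_le hab] at this
  exact h1.congr h.2

theorem mono_left (h : IsPrimitive γ g a b) {a' b' : ℝ} (ha : a ≤ a') (hab : a' ≤ b')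
    (hb : b' ≤ b) : IsPrimitive γ g a' b' := by
  have i1 : IntervalIntegrable g volume a a' := h.1.mono_set (by
    rw [uIcc_of_le ha, uIcc_of_le (ha.trans (hab.trans hb))]; exact Icc_subset_Icc_right (hab.trans hb))
  have i2 : IntervalIntegrable g volume a' b' := h.1.mono_set (by
    rw [uIcc_of_le hab, uIcc_of_le (ha.trans (hab.trans hb))]; exact Icc_subset_Icc ha hb)
  refine ⟨i2, fun y hy => ?_⟩
  have i3 : IntervalIntegrable g volume a' y := i2.mono_set (by
    rw [uIcc_of_le hab, uIcc_of_le hy.1]; exact Icc_subset_Icc_right hy.2)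
  rw [h.2 y ⟨ha.trans hy.1, hy.2.trans hb⟩, h.2 a' ⟨ha, hab.trans hb⟩, add_assoc,
    intervalIntegral.integral_add_adjacent_intervals i1 i3]

theorem congr (h : IsPrimitive γ g a b) (hab : a ≤ b) {γ' g' : ℝ → Plane}
    (hγ : EqOn γ' γ (Icc a b)) (hg : EqOn g' g (Ioc a b)) : IsPrimitive γ' g' a b := by
  refine ⟨h.1.congr (by rw [uIoc_of_le hab]; exact hg.symm), fun y hy => ?_⟩
  rw [hγ hy, hγ ⟨le_rfl, hab⟩, h.2 y hy]
  congr 1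
  apply intervalIntegral.integral_congr_ae
  refine Eventually.of_forall fun t ht => ?_
  rw [uIoc_of_le hy.1] at ht
  exact (hg ⟨ht.1, ht.2.trans hy.2⟩).symm

theorem trans (h : IsPrimitive γ g a b) (h' : IsPrimitive γ g b d) (hab : a ≤ b) :
    IsPrimitive γ g a d := by
  refine ⟨h.1.trans h'.1, fun y hy => ?_⟩
  rcases le_total y b with hyb | hyb
  · exact h.2 y ⟨hy.1, hyb⟩
  · have i3 : IntervalIntegrable g volume b y := h'.1.mono_set (by
      rw [uIcc_of_le (hyb.trans hy.2), uIcc_of_le hyb]; exact Icc_subset_Icc_right hy.2)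
    rw [h'.2 y ⟨hyb, hy.2⟩, h.2 b ⟨hab, le_rfl⟩, add_assoc,
      intervalIntegral.integral_add_adjacent_intervals h.1 i3]

/-- Affine reparametrisation. -/
theorem comp_affine {r s : ℝ} (h : IsPrimitive γ g (r * a + s) (r * b + s))
    (hr : 0 < r) :
    IsPrimitive (fun t => γ (r * t + s)) (fun t => r • g (r * t + s)) a b := by
  constructor
  · have h2 := (h.1.comp_add_right s).comp_mul_left (c := r)
    have h3 : IntervalIntegrable (fun t => g (r * t + s)) volume a b := by
      convert h2 using 1 <;> field_simp <;> ring
    exact h3.smul r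
  · intro y hy
    have hy' : r * y + s ∈ Icc (r * a + s) (r * b + s) :=
      ⟨by have := mul_le_mul_of_nonneg_left hy.1 hr.le; linarith,
       by have := mul_le_mul_of_nonneg_left hy.2 hr.le; linarith⟩
    show γ (r * y + s) = γ (r * a + s) + _
    rw [h.2 _ hy', intervalIntegral.integral_smul, intervalIntegral.smul_integral_comp_mul_add]

/-- Reversal of a curve. -/
theorem comp_neg (h : IsPrimitive γ g a b) (hab : a ≤ b) :
    IsPrimitive (fun t => γ (-t)) (fun t => -g (-t)) (-b) (-a) := by
  have hi : ∀ x ∈ Icc a b, ∀ y ∈ Icc a b, IntervalIntegrable g volume x y := fun x hx y hy =>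
    h.1.mono_set (by rw [uIcc_of_le hab]; exact uIcc_subset_Icc hx hy)
  constructor
  · have := (h.1.comp_mul_left (c := -1)).symm.neg
    have e : (-fun x => g (-1 * x)) = fun t => -g (-t) := by
      funext t; simp
    rw [e] at this
    simpa [div_neg] using this
  · intro y hy
    have hy' : -y ∈ Icc a b := ⟨by linarith [hy.2], by linarith [hy.1]⟩
    show γ (-y) = γ (- -b) + _
    rw [neg_neg, h.2 _ hy', h.2 b ⟨hab, le_rfl⟩, intervalIntegral.integral_neg,
      intervalIntegral.integral_comp_neg, neg_neg,
      ← intervalIntegral.integral_add_adjacent_intervals (hi a ⟨le_rfl, hab⟩ _ hy')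
        (hi _ hy' b ⟨hab, le_rfl⟩)]
    abel

theorem intervalIntegrable_lengthDensity (h : IsPrimitive γ g a b) (hab : a ≤ b) (c : ℝ) :
    IntervalIntegrable (lengthDensity c γ g) volume a b := by
  refine h.1.norm.continuousOn_mul ?_
  rw [uIcc_of_le hab]
  exact ((continuous_bulkNonneg c).comp_continuousOn (h.continuousOn hab)).sqrt

end IsPrimitive

theorem isPrimitive_of_contDiffOn {γ : ℝ → Plane} (h : ContDiffOn ℝ 1 γ (Icc (-1) 1)) :
    IsPrimitive γ (derivWithin γ (Icc (-1) 1)) (-1) 1 := by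
  have hc : ContinuousOn (derivWithin γ (Icc (-1) 1)) (Icc (-1) 1) :=
    h.continuousOn_derivWithin (uniqueDiffOn_Icc (by norm_num)) le_rfl
  have hi : IntervalIntegrable (derivWithin γ (Icc (-1) 1)) volume (-1) 1 :=
    ContinuousOn.intervalIntegrable (by rwa [uIcc_of_le (by norm_num)])
  refine ⟨hi, fun y hy => ?_⟩
  rw [intervalIntegral.integral_eq_sub_of_hasDerivAt_of_le hy.1
    (h.continuousOn.mono (Icc_subset_Icc_right hy.2))]
  · abel
  · intro x hx
    have hx' : x ∈ Ioo (-1 : ℝ) 1 := ⟨hx.1, hx.2.trans_le hy.2⟩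
    exact ((h.differentiableOn one_ne_zero x (Ioo_subset_Icc_self hx')).hasDerivWithinAt).hasDerivAt
      (Icc_mem_nhds hx'.1 hx'.2)
  · exact hi.mono_set (by
      rw [uIcc_of_le hy.1, uIcc_of_le (by norm_num)]; exact Icc_subset_Icc_right hy.2)

theorem weightedLength_eq (c : ℝ) (γ : ℝ → Plane) :
    weightedLength c γ =
      ∫ t in (-1 : ℝ)..1, lengthDensity c γ (derivWithin γ (Icc (-1) 1)) t := by
  rw [weightedLength, intervalIntegral.integral_of_le (by norm_num), integral_Ioc_eq_integral_Ioo]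
  rfl

/-! ### The degenerate metric, tested with absolutely continuous curves. -/

theorem weightedLength_nonneg (c : ℝ) (γ : ℝ → Plane) : 0 ≤ weightedLength c γ :=
  integral_nonneg fun _ => by positivity

theorem geoDist_nonneg (c : ℝ) (a b : Plane) : 0 ≤ geoDist c a b :=
  Real.sInf_nonneg (by rintro _ ⟨γ, -, -, -, rfl⟩; exact weightedLength_nonneg c γ)

theorem geoDist_le_weightedLength (c : ℝ) {γ : ℝ → Plane} (h : ContDiffOn ℝ 1 γ (Icc (-1) 1)) :
    geoDist c (γ (-1)) (γ 1) ≤ weightedLength c γ :=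
  csInf_le ⟨0, by rintro _ ⟨γ, -, -, -, rfl⟩; exact weightedLength_nonneg c γ⟩
    ⟨γ, h, rfl, rfl, rfl⟩

theorem exists_weightedLength_lt (c : ℝ) (a b : Plane) {ε : ℝ} (hε : 0 < ε) :
    ∃ γ : ℝ → Plane, ContDiffOn ℝ 1 γ (Icc (-1) 1) ∧ γ (-1) = a ∧ γ 1 = b ∧
      weightedLength c γ < geoDist c a b + ε := by
  have hne : {L : ℝ | ∃ γ : ℝ → Plane, ContDiffOn ℝ 1 γ (Icc (-1) 1) ∧ γ (-1) = a ∧ γ 1 = b ∧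
      L = weightedLength c γ}.Nonempty := by
    refine ⟨_, fun t => a + ((t + 1) / 2) • (b - a), ?_, ?_, ?_, rfl⟩
    · exact ContDiff.contDiffOn (by fun_prop)
    · simp
    · norm_num
  obtain ⟨_, ⟨γ, h1, h2, h3, rfl⟩, h⟩ := exists_lt_of_csInf_lt hne (lt_add_of_pos_right _ hε)
  exact ⟨γ, h1, h2, h3, h⟩

theorem exists_continuous_integral_norm_sub_le {g : ℝ → Plane} {a b : ℝ} (hab : a ≤ b)
    (hg : IntervalIntegrable g volume a b) {η : ℝ} (hη : 0 < η) :
    ∃ h : ℝ → Plane, Continuous h ∧ ∫ t in a..b, ‖g t - h t‖ ≤ η := by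
  have hi : Integrable ((Ioc a b).indicator g) volume :=
    (integrable_indicator_iff measurableSet_Ioc).2
      ((intervalIntegrable_iff_integrableOn_Ioc_of_le hab).1 hg)
  obtain ⟨h, -, h1, h2, h3⟩ := hi.exists_hasCompactSupport_integral_sub_le hη
  refine ⟨h, h2, le_trans ?_ h1⟩
  rw [intervalIntegral.integral_of_le hab]
  calc ∫ t in Ioc a b, ‖g t - h t‖ = ∫ t in Ioc a b, ‖(Ioc a b).indicator g t - h t‖ :=
        setIntegral_congr_fun measurableSet_Ioc fun t ht => by simp only [indicator_of_mem ht]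
    _ ≤ _ := setIntegral_le_integral (hi.sub h3).norm (Eventually.of_forall fun _ => norm_nonneg _)

/-- The metric is defined with `C¹` curves, but Sobolev maps and concatenations are only absolutely
continuous. Approximate the derivative in `L¹` by a continuous function, add a constant to restore
the end point, and integrate. The resulting `C¹` curve is uniformly close to `γ`, and uniform
continuity of the weight on a ball makes its length exceed that of `γ` by as little as desired. -/
theorem geoDist_le_of_isPrimitive_unit (c : ℝ) {γ g : ℝ → Plane} (h : IsPrimitive γ g (-1) 1) :
    geoDist c (γ (-1)) (γ 1) ≤ ∫ t in (-1 : ℝ)..1, lengthDensity c γ g t := by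
  have h11 : (-1 : ℝ) ≤ 1 := by norm_num
  have hγc := h.continuousOn h11
  obtain ⟨R, hR⟩ := (isCompact_Icc.image_of_continuousOn hγc).isBounded.exists_norm_le
  have hR' : ∀ t ∈ Icc (-1 : ℝ) 1, ‖γ t‖ ≤ R := fun t ht => hR _ ⟨t, ht, rfl⟩
  set w : Plane → ℝ := fun p => Real.sqrt (bulkNonneg c p) with hw
  have hwc : Continuous w := (continuous_bulkNonneg c).sqrt
  have hcomp : IsCompact (Metric.closedBall (0 : Plane) (R + 1)) := isCompact_closedBall _ _
  obtain ⟨S, hS⟩ := hcomp.exists_bound_of_continuousOn hwc.continuousOn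
  have huc := hcomp.uniformContinuousOn_of_continuous hwc.continuousOn
  rw [Metric.uniformContinuousOn_iff] at huc
  have hS0 : 0 ≤ S := (norm_nonneg _).trans (hS (γ (-1)) (by
    rw [mem_closedBall_zero_iff]; linarith [hR' (-1) ⟨le_rfl, h11⟩]))
  set A := ∫ t in (-1 : ℝ)..1, ‖g t‖ with hA
  have hA0 : 0 ≤ A := intervalIntegral.integral_nonneg h11 fun _ _ => norm_nonneg _
  have key : ∀ ε > 0, geoDist c (γ (-1)) (γ 1) ≤
      (∫ t in (-1 : ℝ)..1, lengthDensity c γ g t) + ε * (A + S) := by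
    intro ε hε
    obtain ⟨δ, hδ, huc⟩ := huc ε hε
    -- The new curve is within `2η` of `γ`, both uniformly and in the `L¹` norm of the derivative.
    -- The three bounds give `2η < δ` (uniform continuity of the weight), `2η ≤ ε` (error in the
    -- derivative) and `2η ≤ 1` (the curve stays in the ball of radius `R + 1`).
    set η := min (min (δ / 4) (ε / 2)) (1 / 2) with hη
    have hηpos : 0 < η := by positivity
    have hη1 : η ≤ δ / 4 := (min_le_left _ _).trans (min_le_left _ _)
    have hη2 : η ≤ ε / 2 := (min_le_left _ _).trans (min_le_right _ _)
    have hη3 : η ≤ 1 / 2 := min_le_right _ _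
    obtain ⟨k, hkc, hk⟩ := exists_continuous_integral_norm_sub_le h11 h.1 hηpos
    have hki : IntervalIntegrable k volume (-1) 1 := hkc.intervalIntegrable _ _
    -- The mean of `g - k` over an interval of length `2`: adding it to `k` gives the derivative the
    -- same total integral as `g`.
    set e : Plane := (1 / 2 : ℝ) • (∫ t in (-1 : ℝ)..1, (g t - k t)) with he
    have he_norm : ‖e‖ ≤ η / 2 := by
      rw [he, norm_smul]
      have := (intervalIntegral.norm_integral_le_integral_norm h11 (f := fun t => g t - k t)
        (μ := volume)).trans hk
      norm_num
      linarith
    set G : ℝ → Plane := fun t => k t + e with hG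
    have hGc : Continuous G := by fun_prop
    have hGi : ∀ x y, IntervalIntegrable G volume x y := fun x y => hGc.intervalIntegrable _ _
    set Γ : ℝ → Plane := fun y => γ (-1) + ∫ t in (-1 : ℝ)..y, G t with hΓ
    have hΓd : ∀ y, HasDerivAt Γ (G y) y := fun y =>
      (intervalIntegral.integral_hasDerivAt_right (hGi _ _)
        hGc.stronglyMeasurable.stronglyMeasurableAtFilter hGc.continuousAt).const_add _
    have hΓC : ContDiff ℝ 1 Γ := by
      rw [contDiff_one_iff_deriv]
      refine ⟨fun y => (hΓd y).differentiableAt, ?_⟩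
      rwa [funext fun y => (hΓd y).deriv]
    have hdist : ∫ t in (-1 : ℝ)..1, ‖G t - g t‖ ≤ 2 * η := by
      calc ∫ t in (-1 : ℝ)..1, ‖G t - g t‖ ≤ ∫ t in (-1 : ℝ)..1, (‖g t - k t‖ + ‖e‖) := by
            refine intervalIntegral.integral_mono_on h11 ((hGi _ _).sub h.1).norm
              ((h.1.sub hki).norm.add intervalIntegrable_const) fun t _ => ?_
            calc ‖G t - g t‖ = ‖-(g t - k t) + e‖ := by congr 1; rw [hG]; simp only; abel
              _ ≤ _ := (norm_add_le _ _).trans (by rw [norm_neg])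
        _ ≤ η + 2 * ‖e‖ := by
            rw [intervalIntegral.integral_add (h.1.sub hki).norm intervalIntegrable_const,
              intervalIntegral.integral_const]
            norm_num
            linarith
        _ ≤ 2 * η := by linarith
    have hsup : ∀ y ∈ Icc (-1 : ℝ) 1, ‖Γ y - γ y‖ ≤ 2 * η := by
      intro y hy
      have hgy : IntervalIntegrable g volume (-1) y := (h.mono_left le_rfl hy.1 hy.2).1
      have : Γ y - γ y = ∫ t in (-1 : ℝ)..y, (G t - g t) := by
        rw [h.2 y hy, intervalIntegral.integral_sub (hGi _ _) hgy, hΓ]; simp only; abel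
      rw [this]
      refine (intervalIntegral.norm_integral_le_integral_norm hy.1).trans (le_trans ?_ hdist)
      exact intervalIntegral.integral_mono_interval le_rfl hy.1 hy.2
        (Eventually.of_forall fun _ => norm_nonneg _) ((hGi _ _).sub h.1).norm
    have hend : Γ 1 = γ 1 := by
      rw [h.2 1 ⟨h11, le_rfl⟩, hΓ]
      simp only [hG]
      rw [intervalIntegral.integral_add hki intervalIntegrable_const,
        intervalIntegral.integral_const, he, intervalIntegral.integral_sub h.1 hki, smul_smul]
      norm_num
    have hstart : Γ (-1) = γ (-1) := by simp [hΓ]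
    have hlen : weightedLength c Γ = ∫ t in (-1 : ℝ)..1, lengthDensity c Γ G t := by
      rw [weightedLength, intervalIntegral.integral_of_le h11, integral_Ioc_eq_integral_Ioo]
      refine setIntegral_congr_fun measurableSet_Ioo fun t ht => ?_
      simp only [lengthDensity]
      rw [((hΓd t).hasDerivWithinAt).derivWithin
        (uniqueDiffOn_Icc (by norm_num) t (Ioo_subset_Icc_self ht))]
    have hle := geoDist_le_weightedLength c hΓC.contDiffOn
    rw [hend, hstart, hlen] at hle
    refine hle.trans ?_
    have hI := h.intervalIntegrable_lengthDensity h11 c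
    have hI2 : IntervalIntegrable (fun t => ε * ‖g t‖) volume (-1) 1 := h.1.norm.const_mul _
    have hI3 : IntervalIntegrable (fun t => S * ‖G t - g t‖) volume (-1) 1 :=
      ((hGi _ _).sub h.1).norm.const_mul _
    calc ∫ t in (-1 : ℝ)..1, lengthDensity c Γ G t
        ≤ ∫ t in (-1 : ℝ)..1, (lengthDensity c γ g t + ε * ‖g t‖ + S * ‖G t - g t‖) := by
          refine intervalIntegral.integral_mono_on h11 ?_ ((hI.add hI2).add hI3) fun t ht => ?_
          · refine Continuous.intervalIntegrable ?_ _ _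
            unfold lengthDensity
            exact (hwc.comp hΓC.continuous).mul hGc.norm
          · have hb1 : γ t ∈ Metric.closedBall (0 : Plane) (R + 1) := by
              rw [mem_closedBall_zero_iff]; linarith [hR' t ht]
            have hd := hsup t ht
            have hb2 : Γ t ∈ Metric.closedBall (0 : Plane) (R + 1) := by
              rw [mem_closedBall_zero_iff]
              have : ‖Γ t‖ ≤ ‖γ t‖ + ‖Γ t - γ t‖ := by
                simpa using norm_add_le (γ t) (Γ t - γ t)
              linarith [hR' t ht]
            have hw1 := huc _ hb2 _ hb1 (by rw [dist_eq_norm]; linarith)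
            rw [Real.dist_eq] at hw1
            have hw2 := (le_abs_self _).trans hw1.le
            have hw3 := (le_abs_self _).trans (hS _ hb2)
            have hw0 : 0 ≤ w (Γ t) := Real.sqrt_nonneg _
            have hn : ‖G t‖ ≤ ‖g t‖ + ‖G t - g t‖ := by
              simpa using norm_add_le (g t) (G t - g t)
            show w (Γ t) * ‖G t‖ ≤ w (γ t) * ‖g t‖ + ε * ‖g t‖ + S * ‖G t - g t‖
            nlinarith [norm_nonneg (g t), norm_nonneg (G t - g t),
              mul_le_mul_of_nonneg_left hn hw0,
              mul_le_mul_of_nonneg_right hw3 (norm_nonneg (G t - g t)),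
              mul_le_mul_of_nonneg_right hw2 (norm_nonneg (g t))]
      _ = (∫ t in (-1 : ℝ)..1, lengthDensity c γ g t) + ε * A
            + S * ∫ t in (-1 : ℝ)..1, ‖G t - g t‖ := by
          rw [intervalIntegral.integral_add (hI.add hI2) hI3, intervalIntegral.integral_add hI hI2,
            intervalIntegral.integral_const_mul, intervalIntegral.integral_const_mul]
      _ ≤ _ := by
          have := mul_le_mul_of_nonneg_left (hdist.trans (by linarith : 2 * η ≤ ε)) hS0
          linarith
  refine le_of_forall_pos_le_add fun ε hε => ?_
  refine (key (ε / (A + S + 1)) (by positivity)).trans ?_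
  gcongr
  rw [div_mul_eq_mul_div, div_le_iff₀ (by positivity)]
  nlinarith

/-- The geodesic distance between the end points of an absolutely continuous curve is at most
its weighted length. -/
theorem geoDist_le_of_isPrimitive (c : ℝ) {γ g : ℝ → Plane} {a b : ℝ} (hab : a ≤ b)
    (h : IsPrimitive γ g a b) :
    geoDist c (γ a) (γ b) ≤ ∫ t in a..b, lengthDensity c γ g t := by
  rcases hab.eq_or_lt with rfl | hab
  · have h0 : IsPrimitive (fun _ => γ a) (fun _ => 0) (-1) 1 :=
      ⟨intervalIntegrable_const, fun y _ => by simp⟩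
    simpa [lengthDensity] using geoDist_le_of_isPrimitive_unit c h0
  · have e1 : (b - a) / 2 * (-1) + (a + b) / 2 = a := by ring
    have e2 : (b - a) / 2 * 1 + (a + b) / 2 = b := by ring
    have hr : 0 < (b - a) / 2 := by linarith
    have h' : IsPrimitive γ g ((b - a) / 2 * (-1) + (a + b) / 2) ((b - a) / 2 * 1 + (a + b) / 2) := by
      rwa [e1, e2]
    have := geoDist_le_of_isPrimitive_unit c (h'.comp_affine hr)
    simp only [e1, e2] at this
    refine this.trans (le_of_eq ?_)
    have h2 := intervalIntegral.smul_integral_comp_mul_add (a := -1) (b := 1)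
      (lengthDensity c γ g) ((b - a) / 2) ((a + b) / 2)
    rw [e1, e2] at h2
    rw [← h2, smul_eq_mul, ← intervalIntegral.integral_const_mul]
    refine intervalIntegral.integral_congr fun t _ => ?_
    simp only [lengthDensity, norm_smul, Real.norm_eq_abs, abs_of_pos hr]
    ring

theorem geoDist_comm (c : ℝ) (a b : Plane) : geoDist c a b = geoDist c b a := by
  have key : ∀ a b : Plane, geoDist c a b ≤ geoDist c b a := by
    intro a b
    refine le_of_forall_pos_le_add fun ε hε => ?_
    obtain ⟨γ, h1, h2, h3, h4⟩ := exists_weightedLength_lt c b a hε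
    have h5 := geoDist_le_of_isPrimitive c (by norm_num)
      ((isPrimitive_of_contDiffOn h1).comp_neg (by norm_num))
    simp only [neg_neg, h2, h3] at h5
    refine h5.trans (le_trans (le_of_eq ?_) h4.le)
    rw [weightedLength_eq]
    have := intervalIntegral.integral_comp_neg (a := -1) (b := 1)
      (lengthDensity c γ (derivWithin γ (Icc (-1) 1)))
    rw [neg_neg] at this
    rw [← this]
    refine intervalIntegral.integral_congr fun t _ => ?_
    simp only [lengthDensity, norm_neg]
  exact le_antisymm (key a b) (key b a)

/-- Two concatenated `C¹` curves form a corner and are not a competitor in the definition. They are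
absolutely continuous, so `geoDist_le_of_isPrimitive` still applies. -/
theorem geoDist_triangle (c : ℝ) (x y z : Plane) :
    geoDist c x z ≤ geoDist c x y + geoDist c y z := by
  refine le_of_forall_pos_le_add fun ε hε => ?_
  obtain ⟨α, h1, h2, h3, h4⟩ := exists_weightedLength_lt c x y (half_pos hε)
  obtain ⟨β, k1, k2, k3, k4⟩ := exists_weightedLength_lt c y z (half_pos hε)
  have hα := isPrimitive_of_contDiffOn h1
  have hβ := isPrimitive_of_contDiffOn k1
  set α' := derivWithin α (Icc (-1) 1)
  set β' := derivWithin β (Icc (-1) 1)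
  have hβ2 : IsPrimitive (fun t => β (1 * t + -2)) (fun t => (1 : ℝ) • β' (1 * t + -2)) 1 3 := by
    apply IsPrimitive.comp_affine _ one_pos
    norm_num
    exact hβ
  set γ : ℝ → Plane := fun t => if t ≤ 1 then α t else β (1 * t + -2) with hγ
  set g : ℝ → Plane := fun t => if t ≤ 1 then α' t else (1 : ℝ) • β' (1 * t + -2) with hg
  have e1 : ∀ t, t ≤ 1 → γ t = α t := fun t ht => if_pos ht
  have e2 : ∀ t, 1 ≤ t → γ t = β (1 * t + -2) := fun t ht => by
    rcases ht.eq_or_lt with rfl | ht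
    · rw [e1 1 le_rfl, h3]; norm_num; exact k2.symm
    · exact if_neg (not_le.2 ht)
  have e3 : ∀ t, t ≤ 1 → g t = α' t := fun t ht => if_pos ht
  have e4 : ∀ t, 1 < t → g t = (1 : ℝ) • β' (1 * t + -2) := fun t ht => if_neg (not_le.2 ht)
  have p1 : IsPrimitive γ g (-1) 1 :=
    hα.congr (by norm_num) (fun t ht => e1 t ht.2) (fun t ht => e3 t ht.2)
  have p2 : IsPrimitive γ g 1 3 :=
    hβ2.congr (by norm_num) (fun t ht => e2 t ht.1) (fun t ht => e4 t ht.1)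
  have h5 := geoDist_le_of_isPrimitive c (by norm_num) (p1.trans p2 (by norm_num))
  have e5 : γ 3 = z := by rw [e2 3 (by norm_num), ← k3]; norm_num
  rw [e1 (-1) (by norm_num), h2, e5, ← intervalIntegral.integral_add_adjacent_intervals
    (p1.intervalIntegrable_lengthDensity (by norm_num) c)
    (p2.intervalIntegrable_lengthDensity (by norm_num) c)] at h5
  have i1 : ∫ t in (-1 : ℝ)..1, lengthDensity c γ g t = weightedLength c α := by
    rw [weightedLength_eq]
    refine intervalIntegral.integral_congr fun t ht => ?_
    rw [uIcc_of_le (by norm_num)] at ht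
    simp only [lengthDensity, e1 t ht.2, e3 t ht.2]; rfl
  have i2 : ∫ t in (1 : ℝ)..3, lengthDensity c γ g t = weightedLength c β := by
    rw [weightedLength_eq]
    have := intervalIntegral.smul_integral_comp_mul_add (a := 1) (b := 3)
      (lengthDensity c β β') 1 (-2)
    rw [show (1 : ℝ) * 1 + -2 = -1 by norm_num, show (1 : ℝ) * 3 + -2 = 1 by norm_num,
      one_smul] at this
    rw [← this]
    refine intervalIntegral.integral_congr_ae (Eventually.of_forall fun t ht => ?_)
    rw [uIoc_of_le (by norm_num)] at ht
    simp only [lengthDensity, e2 t ht.1.le, e4 t ht.1, one_smul, one_mul]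
  rw [i1, i2] at h5
  linarith

/-- On bounded sets, the geodesic distance is bounded by a multiple of the Euclidean one. -/
theorem exists_geoDist_le_mul_norm_sub (c R : ℝ) : ∃ C : ℝ, 0 ≤ C ∧ ∀ x y : Plane, ‖x‖ ≤ R → ‖y‖ ≤ R →
    geoDist c x y ≤ C * ‖x - y‖ := by
  obtain ⟨S, hS⟩ := (isCompact_closedBall (0 : Plane) R).exists_bound_of_continuousOn
    (continuous_bulkNonneg c).sqrt.continuousOn
  refine ⟨|S|, abs_nonneg _, fun x y hx hy => ?_⟩
  have hp : IsPrimitive (fun t : ℝ => x + t • (y - x)) (fun _ => y - x) 0 1 :=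
    ⟨intervalIntegrable_const, fun t _ => by
      simp only [intervalIntegral.integral_const, zero_smul, add_zero, sub_zero]⟩
  have h := geoDist_le_of_isPrimitive c zero_le_one hp
  simp only [zero_smul, add_zero, one_smul, add_sub_cancel] at h
  refine h.trans ?_
  rw [norm_sub_rev]
  calc ∫ t in (0 : ℝ)..1, lengthDensity c (fun t : ℝ => x + t • (y - x)) (fun _ => y - x) t
      ≤ ∫ t in (0 : ℝ)..1, |S| * ‖y - x‖ := by
        refine intervalIntegral.integral_mono_on zero_le_one
          (hp.intervalIntegrable_lengthDensity zero_le_one c) intervalIntegrable_const fun t ht => ?_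
        refine mul_le_mul_of_nonneg_right ?_ (norm_nonneg _)
        refine (le_abs_self _).trans ((hS _ ?_).trans (le_abs_self _))
        have := (convex_closedBall (0 : Plane) R).add_smul_sub_mem
          (mem_closedBall_zero_iff.2 hx) (mem_closedBall_zero_iff.2 hy) ht
        exact this
    _ = |S| * ‖y - x‖ := by simp

/-- A calibration: the weight is at least `|M² - m²| / √K`, so the length of any curve is at least
`1/√K` times the integral of the exact form `(M² - m²) dM` from `m` to `-m`. That integral is
`4m³/3`, whatever the curve. -/
theorem geoDist_pStar_pStarStar_pos {c : ℝ} (hc : 0 < c) :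
    0 < geoDist c (pStar c) (pStarStar c) := by
  obtain ⟨K, hK, hb⟩ := exists_sq_le_bulkNonneg hc
  set m := mStar c with hm
  have hm0 : 0 < m := mStar_pos hc
  have hpos : 0 < 4 / 3 * m ^ 3 / Real.sqrt K := by positivity
  refine hpos.trans_le (le_of_forall_pos_le_add fun ε hε => ?_)
  obtain ⟨γ, h1, h2, h3, h4⟩ := exists_weightedLength_lt c (pStar c) (pStarStar c) hε
  refine le_trans ?_ h4.le
  have h11 : (-1 : ℝ) ≤ 1 := by norm_num
  set γ' := derivWithin γ (Icc (-1) 1) with hγ'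
  have hc' : ContinuousOn γ' (Icc (-1) 1) :=
    h1.continuousOn_derivWithin (uniqueDiffOn_Icc (by norm_num)) le_rfl
  have hcoord : Continuous fun p : Plane => p 1 := by fun_prop
  have hint : ContinuousOn (fun t => (γ t 1 ^ 2 - m ^ 2) * γ' t 1) (Icc (-1) 1) :=
    ContinuousOn.mul (((hcoord.comp_continuousOn h1.continuousOn).pow 2).sub continuousOn_const)
      (hcoord.comp_continuousOn hc')
  have hint' : IntervalIntegrable (fun t => (γ t 1 ^ 2 - m ^ 2) * γ' t 1) volume (-1) 1 :=
    ContinuousOn.intervalIntegrable (by rwa [uIcc_of_le h11])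
  have hftc : ∫ t in (-1 : ℝ)..1, (γ t 1 ^ 2 - m ^ 2) * γ' t 1 = 4 / 3 * m ^ 3 := by
    rw [intervalIntegral.integral_eq_sub_of_hasDerivAt_of_le
      (f := fun t => γ t 1 ^ 3 / 3 - m ^ 2 * γ t 1) h11]
    · simp only [h2, h3, pStar_one, pStarStar_one, ← hm]; ring
    · have := hcoord.comp_continuousOn h1.continuousOn
      exact ((this.pow 3).div_const 3).sub (continuousOn_const.mul this)
    · intro x hx
      have hd : HasDerivAt γ (γ' x) x :=
        ((h1.differentiableOn one_ne_zero x (Ioo_subset_Icc_self hx)).hasDerivWithinAt).hasDerivAt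
          (Icc_mem_nhds hx.1 hx.2)
      have hd1 : HasDerivAt (fun t => γ t 1) (γ' x 1) x :=
        (EuclideanSpace.proj (1 : Fin 2) : Plane →L[ℝ] ℝ).hasFDerivAt.comp_hasDerivAt x hd
      refine (((hd1.pow 3).div_const 3).sub (hd1.const_mul (m ^ 2))).congr_deriv ?_
      norm_num
      ring
    · exact hint'
  rw [weightedLength_eq, ← hftc, ← intervalIntegral.integral_div]
  refine intervalIntegral.integral_mono_on h11 (hint'.div_const _)
    ((isPrimitive_of_contDiffOn h1).intervalIntegrable_lengthDensity h11 c) fun t _ => ?_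
  have hF := (hb (γ t)).2
  have h5 : |γ t 1 ^ 2 - m ^ 2| ≤ Real.sqrt K * Real.sqrt (bulkNonneg c (γ t)) := by
    rw [← Real.sqrt_mul hK.le]; exact Real.abs_le_sqrt hF
  have h6 : |γ' t 1| ≤ ‖γ' t‖ := by
    simpa using PiLp.norm_apply_le (γ' t) 1
  rw [div_le_iff₀ (Real.sqrt_pos.2 hK)]
  calc (γ t 1 ^ 2 - m ^ 2) * γ' t 1 ≤ |γ t 1 ^ 2 - m ^ 2| * |γ' t 1| := by
        rw [← abs_mul]; exact le_abs_self _
    _ ≤ (Real.sqrt K * Real.sqrt (bulkNonneg c (γ t))) * ‖γ' t‖ := by gcongr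
    _ = _ := by unfold lengthDensity; ring

/-! ### Weak derivatives -/

/-- The smooth step equal to `0` left of `x` and to `1` right of `x + r`. -/
def smoothStep (x r y : ℝ) : ℝ := Real.smoothTransition ((y - x) / r)

theorem contDiff_smoothStep (x r : ℝ) : ContDiff ℝ ∞ (smoothStep x r) := by
  unfold smoothStep
  exact Real.smoothTransition.contDiff.comp ((contDiff_id.sub contDiff_const).div_const r)

theorem monotone_smoothStep (x : ℝ) {r : ℝ} (hr : 0 < r) : Monotone (smoothStep x r) :=
  fun a b hab => Real.smoothTransition.monotone (by gcongr)

theorem smoothStep_of_le {x r y : ℝ} (hr : 0 < r) (h : y ≤ x) : smoothStep x r y = 0 :=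
  Real.smoothTransition.zero_of_nonpos (div_nonpos_of_nonpos_of_nonneg (by linarith) hr.le)

theorem smoothStep_of_ge {x r y : ℝ} (hr : 0 < r) (h : x + r ≤ y) : smoothStep x r y = 1 :=
  Real.smoothTransition.one_of_one_le (by rw [le_div_iff₀ hr]; linarith)

theorem deriv_smoothStep_eq_zero {x r y : ℝ} (hr : 0 < r) (h : y ∉ Icc x (x + r)) :
    deriv (smoothStep x r) y = 0 := by
  rw [mem_Icc, not_and_or, not_le, not_le] at h
  rcases h with h | h
  · have : smoothStep x r =ᶠ[𝓝 y] fun _ => 0 := by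
      filter_upwards [Iio_mem_nhds h] with z hz using smoothStep_of_le hr (le_of_lt hz)
    rw [this.deriv_eq, deriv_const]
  · have : smoothStep x r =ᶠ[𝓝 y] fun _ => 1 := by
      filter_upwards [Ioi_mem_nhds h] with z hz using smoothStep_of_ge hr (le_of_lt hz)
    rw [this.deriv_eq, deriv_const]

/-- The derivative of the step is a non-negative kernel of mass one supported in `[x, x + r]`, so
the integral is an average of the values of `u` there. -/
theorem norm_integral_deriv_smoothStep_smul_sub_le {u : ℝ → Plane} {x r ε : ℝ} {v : Plane}
    (hu : ContinuousOn u (Icc (-1) 1)) (hr : 0 < r) (hx : -1 ≤ x) (hx' : x + r ≤ 1)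
    (h : ∀ y ∈ Icc x (x + r), ‖u y - v‖ ≤ ε) :
    ‖(∫ y in (-1 : ℝ)..1, deriv (smoothStep x r) y • u y) - v‖ ≤ ε := by
  have h11 : (-1 : ℝ) ≤ 1 := by norm_num
  have hc := contDiff_smoothStep x r
  have hd : Continuous (deriv (smoothStep x r)) := hc.continuous_deriv (by simp)
  have hint : ∫ y in (-1 : ℝ)..1, deriv (smoothStep x r) y = 1 := by
    rw [intervalIntegral.integral_deriv_eq_sub
      (fun y _ => (hc.differentiable (by simp)).differentiableAt) (hd.intervalIntegrable _ _),
      smoothStep_of_ge hr hx', smoothStep_of_le hr hx, sub_zero]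
  have i1 : IntervalIntegrable (fun y => deriv (smoothStep x r) y • u y) volume (-1) 1 :=
    ContinuousOn.intervalIntegrable (by rw [uIcc_of_le h11]; exact hd.continuousOn.smul hu)
  have i2 : IntervalIntegrable (fun y => deriv (smoothStep x r) y • v) volume (-1) 1 :=
    (hd.smul continuous_const).intervalIntegrable _ _
  have e : (∫ y in (-1 : ℝ)..1, deriv (smoothStep x r) y • u y) - v =
      ∫ y in (-1 : ℝ)..1, deriv (smoothStep x r) y • (u y - v) := by
    simp_rw [smul_sub]
    rw [intervalIntegral.integral_sub i1 i2, intervalIntegral.integral_smul_const, hint, one_smul]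
  rw [e]
  calc _ ≤ ∫ y in (-1 : ℝ)..1, deriv (smoothStep x r) y * ε := by
        refine intervalIntegral.norm_integral_le_of_norm_le h11
          (Eventually.of_forall fun y _ => ?_) ((hd.mul continuous_const).intervalIntegrable _ _)
        have h0 : 0 ≤ deriv (smoothStep x r) y := (monotone_smoothStep x hr).deriv_nonneg
        rw [norm_smul, Real.norm_eq_abs, abs_of_nonneg h0]
        by_cases hy : y ∈ Icc x (x + r)
        · exact mul_le_mul_of_nonneg_left (h y hy) h0
        · rw [deriv_smoothStep_eq_zero hr hy]; simp
    _ = ε := by rw [intervalIntegral.integral_mul_const, hint, one_mul]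

/-- Test the weak derivative with a smooth trapezoid that rises on `[a, a + r]` and falls on `[b -
r, b]`. As `r` shrinks, the two ramps recover `u a` and `u b`, and the plateau recovers the integral
of `g`. -/
theorem IsWeakDeriv.sub_eq_integral {u g : ℝ → Plane} (h : IsWeakDeriv u g)
    (hu : ContinuousOn u (Icc (-1) 1)) (hg : IntervalIntegrable g volume (-1) 1) {a b : ℝ}
    (ha : -1 < a) (hab : a < b) (hb : b < 1) : u b - u a = ∫ t in a..b, g t := by
  have h11 : (-1 : ℝ) ≤ 1 := by norm_num
  have hsub : ∀ x ∈ Icc (-1 : ℝ) 1, ∀ y ∈ Icc (-1 : ℝ) 1, IntervalIntegrable g volume x y :=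
    fun x hx y hy => hg.mono_set (by rw [uIcc_of_le h11]; exact uIcc_subset_Icc hx hy)
  -- Continuity of the primitive of `‖g‖` makes the integrals over the two ramps small. Extension by
  -- zero makes `g` integrable on the whole line.
  have hprim : Continuous fun y => ∫ t in (-1 : ℝ)..y, ‖(Icc (-1) 1).indicator g t‖ := by
    refine intervalIntegral.continuous_primitive (fun x y => ?_) _
    exact (((integrable_indicator_iff measurableSet_Icc).2
      ((intervalIntegrable_iff_integrableOn_Icc_of_le h11).1 hg)).norm).intervalIntegrable
  -- Four errors of size `ε`: one for each average of `u` and one for each ramp in the integral of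
  -- `g`.
  have key : ∀ ε > 0, ‖u b - u a - ∫ t in a..b, g t‖ ≤ ε * 4 := by
    intro ε hε
    have hua : ContinuousAt u a := hu.continuousAt (Icc_mem_nhds ha (hab.trans hb))
    have hub : ContinuousAt u b := hu.continuousAt (Icc_mem_nhds (ha.trans hab) hb)
    obtain ⟨δ1, hδ1, k1⟩ := Metric.continuousAt_iff.1 hua ε hε
    obtain ⟨δ2, hδ2, k2⟩ := Metric.continuousAt_iff.1 hub ε hε
    obtain ⟨δ3, hδ3, k3⟩ := Metric.continuousAt_iff.1 (hprim.continuousAt (x := a)) ε hε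
    obtain ⟨δ4, hδ4, k4⟩ := Metric.continuousAt_iff.1 (hprim.continuousAt (x := b)) ε hε
    set r := min (min (δ1 / 2) (δ2 / 2)) (min (min (δ3 / 2) (δ4 / 2)) ((b - a) / 2)) with hrdef
    have hr : 0 < r := by
      have : 0 < b - a := sub_pos.2 hab
      positivity
    have r1 : r ≤ δ1 / 2 := (min_le_left _ _).trans (min_le_left _ _)
    have r2 : r ≤ δ2 / 2 := (min_le_left _ _).trans (min_le_right _ _)
    have r3 : r ≤ δ3 / 2 := (min_le_right _ _).trans ((min_le_left _ _).trans (min_le_left _ _))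
    have r4 : r ≤ δ4 / 2 := (min_le_right _ _).trans ((min_le_left _ _).trans (min_le_right _ _))
    have r5 : r ≤ (b - a) / 2 := (min_le_right _ _).trans (min_le_right _ _)
    set φ : ℝ → ℝ := fun y => smoothStep a r y - smoothStep (b - r) r y with hφ
    have hφ0 : ∀ y, y ∉ Icc a b → φ y = 0 := by
      intro y hy
      rw [mem_Icc, not_and_or, not_le, not_le] at hy
      rcases hy with hy | hy
      · simp only [hφ]
        rw [smoothStep_of_le hr hy.le, smoothStep_of_le hr (by linarith), sub_zero]
      · simp only [hφ]
        rw [smoothStep_of_ge hr (by linarith), smoothStep_of_ge hr (by linarith), sub_self]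
    have hφ1 : ∀ y ∈ Icc (a + r) (b - r), φ y = 1 := by
      intro y hy
      simp only [hφ]
      rw [smoothStep_of_ge hr hy.1, smoothStep_of_le hr hy.2, sub_zero]
    have hφle : ∀ y, |φ y - 1| ≤ 1 := by
      intro y
      have s1 : ∀ x, 0 ≤ smoothStep x r y := fun x => Real.smoothTransition.nonneg _
      have s2 : ∀ x, smoothStep x r y ≤ 1 := fun x => Real.smoothTransition.le_one _
      have s3 : smoothStep (b - r) r y ≤ smoothStep a r y :=
        Real.smoothTransition.monotone (by gcongr; linarith)
      rw [abs_le]; constructor <;> simp only [hφ] <;> linarith [s1 (b - r), s2 a]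
    have hφc : ContDiff ℝ ∞ φ := (contDiff_smoothStep a r).sub (contDiff_smoothStep (b - r) r)
    have hts : tsupport φ ⊆ Icc a b :=
      closure_minimal (fun y hy => by by_contra h; exact hy (hφ0 y h)) isClosed_Icc
    have hw := h φ hφc (isCompact_Icc.of_isClosed_subset (isClosed_tsupport _) hts)
      (hts.trans fun y hy => ⟨ha.trans_le hy.1, hy.2.trans_lt hb⟩)
    rw [← integral_Ioc_eq_integral_Ioo, ← integral_Ioc_eq_integral_Ioo,
      ← intervalIntegral.integral_of_le h11, ← intervalIntegral.integral_of_le h11] at hw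
    have hdφ : ∀ y, deriv φ y = deriv (smoothStep a r) y - deriv (smoothStep (b - r) r) y :=
      fun y => deriv_sub ((contDiff_smoothStep a r).differentiable (by simp)).differentiableAt
        ((contDiff_smoothStep (b - r) r).differentiable (by simp)).differentiableAt
    have hdi : ∀ x, IntervalIntegrable (fun y => deriv (smoothStep x r) y • u y) volume (-1) 1 :=
      fun x => ContinuousOn.intervalIntegrable (by
        rw [uIcc_of_le h11]
        exact ((contDiff_smoothStep x r).continuous_deriv (by simp)).continuousOn.smul hu)
    simp_rw [hdφ, sub_smul] at hw
    rw [intervalIntegral.integral_sub (hdi _) (hdi _)] at hw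
    have b1 := norm_integral_deriv_smoothStep_smul_sub_le (v := u a) (ε := ε) hu hr ha.le
      (by linarith) fun y hy => by
        have := (k1 (x := y) (by rw [Real.dist_eq, abs_of_nonneg (by linarith [hy.1])]; linarith [hy.2])).le
        rwa [dist_eq_norm] at this
    have b2 := norm_integral_deriv_smoothStep_smul_sub_le (v := u b) (ε := ε) (x := b - r) hu hr
      (by linarith) (by linarith) fun y hy => by
        have := (k2 (x := y) (by
          rw [Real.dist_eq, abs_of_nonpos (by linarith [hy.2])]; linarith [hy.1])).le
        rwa [dist_eq_norm] at this
    have hφg : IntervalIntegrable (fun y => φ y • g y) volume (-1) 1 :=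
      hg.continuousOn_smul hφc.continuous.continuousOn
    have mem : ∀ {x}, a ≤ x → x ≤ b → x ∈ Icc (-1 : ℝ) 1 :=
      fun h1 h2 => ⟨ha.le.trans h1, h2.trans hb.le⟩
    have ind : ∀ {x y}, x ∈ Icc (-1 : ℝ) 1 → y ∈ Icc (-1 : ℝ) 1 →
        (∫ t in x..y, ‖g t‖) = (∫ t in (-1 : ℝ)..y, ‖(Icc (-1) 1).indicator g t‖) -
          ∫ t in (-1 : ℝ)..x, ‖(Icc (-1) 1).indicator g t‖ := by
      intro x y hx hy
      have e : ∀ z ∈ Icc (-1 : ℝ) 1, ∫ t in (-1 : ℝ)..z, ‖(Icc (-1) 1).indicator g t‖ =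
          ∫ t in (-1 : ℝ)..z, ‖g t‖ := fun z hz => by
        refine intervalIntegral.integral_congr fun t ht => ?_
        rw [uIcc_of_le hz.1] at ht
        have : t ∈ Icc (-1 : ℝ) 1 := ⟨ht.1, ht.2.trans hz.2⟩
        simp only [indicator_of_mem this]
      rw [e x hx, e y hy, intervalIntegral.integral_interval_sub_left
        (hsub _ ⟨le_rfl, h11⟩ _ hy).norm (hsub _ ⟨le_rfl, h11⟩ _ hx).norm]
    have b3 : ∫ t in a..a + r, ‖g t‖ ≤ ε := by
      rw [ind (mem le_rfl hab.le) (mem (by linarith) (by linarith))]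
      have := (k3 (x := a + r) (by rw [Real.dist_eq, abs_of_nonneg] <;> linarith)).le
      rw [Real.dist_eq] at this
      exact (le_abs_self _).trans this
    have b4 : ∫ t in b - r..b, ‖g t‖ ≤ ε := by
      rw [ind (mem (by linarith) (by linarith)) (mem hab.le le_rfl)]
      have := (k4 (x := b - r) (by rw [Real.dist_eq, abs_of_nonpos] <;> linarith)).le
      rw [Real.dist_eq, abs_sub_comm] at this
      exact (le_abs_self _).trans this
    have hψi : ∀ x ∈ Icc (-1 : ℝ) 1, ∀ y ∈ Icc (-1 : ℝ) 1,
        IntervalIntegrable (fun y => (φ y - 1) • g y) volume x y := fun x hx y hy =>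
      (hsub x hx y hy).continuousOn_smul (hφc.continuous.sub continuous_const).continuousOn
    have hbd : ∀ x y, x ∈ Icc (-1 : ℝ) 1 → y ∈ Icc (-1 : ℝ) 1 → x ≤ y →
        ‖∫ t in x..y, (φ t - 1) • g t‖ ≤ ∫ t in x..y, ‖g t‖ := fun x y hx hy hxy => by
      refine intervalIntegral.norm_integral_le_of_norm_le hxy (Eventually.of_forall fun t _ => ?_)
        (hsub x hx y hy).norm
      rw [norm_smul]
      exact mul_le_of_le_one_left (norm_nonneg _) (hφle t)
    have b5 : ‖(∫ y in (-1 : ℝ)..1, φ y • g y) - ∫ t in a..b, g t‖ ≤ ε * 2 := by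
      have z1 : ∫ y in (-1 : ℝ)..1, φ y • g y = ∫ y in a..b, φ y • g y := by
        rw [intervalIntegral.integral_of_le h11, intervalIntegral.integral_of_le hab.le,
          ← integral_Icc_eq_integral_Ioc, ← integral_Icc_eq_integral_Ioc]
        refine (setIntegral_eq_of_subset_of_forall_sdiff_eq_zero measurableSet_Icc
          (Icc_subset_Icc ha.le hb.le) fun y hy => ?_)
        rw [hφ0 y hy.2, zero_smul]
      have ma := mem le_rfl hab.le
      have mb := mem hab.le le_rfl
      have mar : a + r ∈ Icc (-1 : ℝ) 1 := mem (by linarith) (by linarith)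
      have mbr : b - r ∈ Icc (-1 : ℝ) 1 := mem (by linarith) (by linarith)
      have z2 : (∫ y in a..b, φ y • g y) - ∫ t in a..b, g t = ∫ t in a..b, (φ t - 1) • g t := by
        rw [← intervalIntegral.integral_sub
          ((hsub _ ma _ mb).continuousOn_smul hφc.continuous.continuousOn) (hsub _ ma _ mb)]
        refine intervalIntegral.integral_congr fun t _ => ?_
        simp only [sub_smul, one_smul]
      have z3 : ∫ t in a + r..b - r, (φ t - 1) • g t = 0 := by
        rw [intervalIntegral.integral_congr (g := fun _ => 0), intervalIntegral.integral_zero]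
        intro t ht
        rw [uIcc_of_le (by linarith)] at ht
        simp only [hφ1 t ht, sub_self, zero_smul]
      rw [z1, z2, ← intervalIntegral.integral_add_adjacent_intervals (hψi _ ma _ mar)
        (hψi _ mar _ mb), ← intervalIntegral.integral_add_adjacent_intervals (hψi _ mar _ mbr)
        (hψi _ mbr _ mb), z3, zero_add]
      refine (norm_add_le _ _).trans ?_
      linarith [hbd _ _ ma mar (by linarith), hbd _ _ mbr mb (by linarith)]
    have e : u b - u a - ∫ t in a..b, g t =
        ((∫ y in (-1 : ℝ)..1, deriv (smoothStep a r) y • u y) - u a) -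
          ((∫ y in (-1 : ℝ)..1, deriv (smoothStep (b - r) r) y • u y) - u b) +
          ((∫ y in (-1 : ℝ)..1, φ y • g y) - ∫ t in a..b, g t) := by
      have : (∫ y in (-1 : ℝ)..1, φ y • g y) = -((∫ y in (-1 : ℝ)..1, deriv (smoothStep a r) y • u y)
          - ∫ y in (-1 : ℝ)..1, deriv (smoothStep (b - r) r) y • u y) := by
        rw [hw, neg_neg]
      rw [this]; abel
    rw [e]
    refine (norm_add_le _ _).trans ?_
    have := norm_sub_le ((∫ y in (-1 : ℝ)..1, deriv (smoothStep a r) y • u y) - u a)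
      ((∫ y in (-1 : ℝ)..1, deriv (smoothStep (b - r) r) y • u y) - u b)
    linarith
  have : ‖u b - u a - ∫ t in a..b, g t‖ ≤ 0 := by
    refine le_of_forall_pos_le_add fun ε hε => ?_
    have := key (ε / 4) (by positivity)
    linarith
  exact sub_eq_zero.1 (norm_le_zero_iff.1 this)

namespace AdmissibleMap

variable (p : AdmissibleMap)

theorem intervalIntegrable_wderiv : IntervalIntegrable p.wderiv volume (-1) 1 := by
  rw [intervalIntegrable_iff_integrableOn_Ioo_of_le (by norm_num)]
  exact p.memLp_wderiv.integrable (by norm_num)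

/-- Test functions only see interior points. The identity reaches `±1` because `u` minus the
primitive of its derivative is continuous on `[-1, 1]` and constant on the dense open interval. -/
theorem isPrimitive : IsPrimitive p.toFun p.wderiv (-1) 1 := by
  have h11 : (-1 : ℝ) ≤ 1 := by norm_num
  have hi := p.intervalIntegrable_wderiv
  refine ⟨hi, ?_⟩
  have hG : ContinuousOn (fun y => ∫ t in (-1 : ℝ)..y, p.wderiv t) (Icc (-1) 1) := by
    have := intervalIntegral.continuousOn_primitive_interval (a := -1) (b := 1) (f := p.wderiv)
      (μ := volume) (by
        rw [uIcc_of_le h11]; exact (intervalIntegrable_iff_integrableOn_Icc_of_le h11).1 hi)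
    rwa [uIcc_of_le h11] at this
  have hsub : ∀ x ∈ Icc (-1 : ℝ) 1, IntervalIntegrable p.wderiv volume (-1) x :=
    fun x hx => hi.mono_set (by
      rw [uIcc_of_le h11, uIcc_of_le hx.1]; exact Icc_subset_Icc_right hx.2)
  have hF : ContinuousOn (fun y => p.toFun y - ∫ t in (-1 : ℝ)..y, p.wderiv t) (Icc (-1) 1) :=
    p.continuousOn.sub hG
  have hlt : ∀ a b : ℝ, -1 < a → a < b → b < 1 →
      p.toFun b - ∫ t in (-1 : ℝ)..b, p.wderiv t = p.toFun a - ∫ t in (-1 : ℝ)..a, p.wderiv t := by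
    intro a b ha hab hb
    have h1 := p.isWeakDeriv.sub_eq_integral p.continuousOn hi ha hab hb
    rw [← intervalIntegral.integral_interval_sub_left (hsub b ⟨(ha.trans hab).le, hb.le⟩)
      (hsub a ⟨ha.le, (hab.trans hb).le⟩)] at h1
    rw [sub_eq_sub_iff_add_eq_add] at h1 ⊢
    rw [h1, add_comm]
  have hconst : EqOn (fun y => p.toFun y - ∫ t in (-1 : ℝ)..y, p.wderiv t)
      (fun _ => p.toFun 0 - ∫ t in (-1 : ℝ)..0, p.wderiv t) (Ioo (-1) 1) := by
    intro y hy
    rcases lt_trichotomy y 0 with h | h | h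
    · exact (hlt y 0 hy.1 h (by norm_num)).symm
    · simp only [h]
    · exact hlt 0 y (by norm_num) h hy.2
  have hall := hconst.of_subset_closure hF continuousOn_const Ioo_subset_Icc_self
    (by rw [closure_Ioo (by norm_num)])
  intro y hy
  have h1 := hall hy
  have h2 := hall (show (-1 : ℝ) ∈ Icc (-1) 1 from ⟨le_rfl, h11⟩)
  simp only [intervalIntegral.integral_same, sub_zero] at h1 h2
  rw [← h2] at h1
  rw [← h1]; abel

/-! ### The lower energy bound -/

theorem integrableOn_bulkNonneg (c : ℝ) :
    IntegrableOn (fun y => bulkNonneg c (p.toFun y)) (Ioo (-1) 1) :=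
  (((continuous_bulkNonneg c).comp_continuousOn p.continuousOn).integrableOn_Icc).mono_set
    Ioo_subset_Icc_self

theorem integrableOn_norm_sq : IntegrableOn (fun y => ‖p.wderiv y‖ ^ 2) (Ioo (-1) 1) :=
  p.memLp_wderiv.integrable_norm_pow (by norm_num)

theorem energy_eq (c l : ℝ) : energy c l p =
    (∫ y in Ioo (-1 : ℝ) 1, Real.sqrt l / 2 * ‖p.wderiv y‖ ^ 2) +
      ∫ y in Ioo (-1 : ℝ) 1, 1 / Real.sqrt l * bulkNonneg c (p.toFun y) := by
  rw [energy, ← integral_add (p.integrableOn_norm_sq.const_mul _)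
    ((p.integrableOn_bulkNonneg c).const_mul _)]
  refine integral_congr_ae (Eventually.of_forall fun y => ?_)
  simp only [norm_sq_eq]
  ring

/-- Dropping the gradient term shows that bounded energy forces the integral of the potential to be
of order `√l`. -/
theorem integral_bulkNonneg_le {c l : ℝ} (hl : 0 < l) :
    ∫ y in Ioo (-1 : ℝ) 1, bulkNonneg c (p.toFun y) ≤ Real.sqrt l * energy c l p := by
  have hs := Real.sqrt_pos.2 hl
  have h0 : 0 ≤ ∫ y in Ioo (-1 : ℝ) 1, Real.sqrt l / 2 * ‖p.wderiv y‖ ^ 2 :=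
    integral_nonneg fun y => by positivity
  rw [p.energy_eq, integral_const_mul _ (fun y => bulkNonneg c (p.toFun y)), mul_add,
    ← mul_assoc, mul_one_div_cancel hs.ne', one_mul]
  linarith [mul_nonneg hs.le h0]

/-- The Modica–Mortola inequality. With `s = √l` and `F² = f̃`, the difference of the densities is
the square `(s|p'| - √2 F)² / (2s)`; the factors `s` and `1/s` cancel in the geometric mean, and the
weights `1/2` and `1` leave `√2`. -/
theorem sqrt_two_mul_integral_lengthDensity_le_energy {c l : ℝ} (hc : 0 < c) (hl : 0 < l) :
    Real.sqrt 2 * ∫ t in (-1 : ℝ)..1, lengthDensity c p.toFun p.wderiv t ≤ energy c l p := by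
  have h11 : (-1 : ℝ) ≤ 1 := by norm_num
  have hs := Real.sqrt_pos.2 hl
  rw [p.energy_eq, ← integral_add (p.integrableOn_norm_sq.const_mul _)
    ((p.integrableOn_bulkNonneg c).const_mul _), intervalIntegral.integral_of_le h11,
    integral_Ioc_eq_integral_Ioo, ← integral_const_mul]
  have hli := p.isPrimitive.intervalIntegrable_lengthDensity h11 c
  rw [intervalIntegrable_iff_integrableOn_Ioo_of_le h11] at hli
  refine integral_mono (hli.const_mul _) ((p.integrableOn_norm_sq.const_mul _).add
    ((p.integrableOn_bulkNonneg c).const_mul _)) fun y => ?_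
  have hF := bulkNonneg_nonneg hc (p.toFun y)
  show Real.sqrt 2 * (Real.sqrt (bulkNonneg c (p.toFun y)) * ‖p.wderiv y‖) ≤
    Real.sqrt l / 2 * ‖p.wderiv y‖ ^ 2 + 1 / Real.sqrt l * bulkNonneg c (p.toFun y)
  set s := Real.sqrt l
  set F := Real.sqrt (bulkNonneg c (p.toFun y)) with hFdef
  have hFsq : bulkNonneg c (p.toFun y) = F ^ 2 := (Real.sq_sqrt hF).symm
  have h2 : Real.sqrt 2 ^ 2 = 2 := Real.sq_sqrt (by norm_num)
  rw [hFsq]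
  have e : s / 2 * ‖p.wderiv y‖ ^ 2 + 1 / s * F ^ 2 - Real.sqrt 2 * (F * ‖p.wderiv y‖) =
      1 / (2 * s) * (s * ‖p.wderiv y‖ - Real.sqrt 2 * F) ^ 2 := by
    field_simp
    ring_nf
    rw [h2]
  have : 0 ≤ 1 / (2 * s) * (s * ‖p.wderiv y‖ - Real.sqrt 2 * F) ^ 2 := by positivity
  linarith

/-- The energy controls the total geodesic length through any three consecutive values. -/
theorem sqrt_two_mul_geoDist_le_energy {c l : ℝ} (hc : 0 < c) (hl : 0 < l) {y₁ y₂ y₃ : ℝ}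
    (h₁ : -1 ≤ y₁) (h₁₂ : y₁ ≤ y₂) (h₂₃ : y₂ ≤ y₃) (h₃ : y₃ ≤ 1) :
    Real.sqrt 2 * (geoDist c pbLeft (p.toFun y₁) + geoDist c (p.toFun y₁) (p.toFun y₂) +
      geoDist c (p.toFun y₂) (p.toFun y₃) + geoDist c (p.toFun y₃) pbRight) ≤ energy c l p := by
  refine le_trans (mul_le_mul_of_nonneg_left ?_ (Real.sqrt_nonneg 2))
    (p.sqrt_two_mul_integral_lengthDensity_le_energy hc hl)
  have P := p.isPrimitive
  have q1 := P.mono_left le_rfl h₁ (h₁₂.trans (h₂₃.trans h₃))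
  have q2 := P.mono_left h₁ h₁₂ (h₂₃.trans h₃)
  have q3 := P.mono_left (h₁.trans h₁₂) h₂₃ h₃
  have q4 := P.mono_left (h₁.trans (h₁₂.trans h₂₃)) h₃ le_rfl
  have i1 := q1.intervalIntegrable_lengthDensity h₁ c
  have i2 := q2.intervalIntegrable_lengthDensity h₁₂ c
  have i3 := q3.intervalIntegrable_lengthDensity h₂₃ c
  have i4 := q4.intervalIntegrable_lengthDensity h₃ c
  rw [← intervalIntegral.integral_add_adjacent_intervals ((i1.trans i2).trans i3) i4,
    ← intervalIntegral.integral_add_adjacent_intervals (i1.trans i2) i3,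
    ← intervalIntegral.integral_add_adjacent_intervals i1 i2]
  have g1 := geoDist_le_of_isPrimitive c h₁ q1
  have g2 := geoDist_le_of_isPrimitive c h₁₂ q2
  have g3 := geoDist_le_of_isPrimitive c h₂₃ q3
  have g4 := geoDist_le_of_isPrimitive c h₃ q4
  rw [p.left_eq] at g1
  rw [p.right_eq] at g4
  linarith

end AdmissibleMap

/-! ### Transition profiles and the upper energy bound -/

/-- A transition profile from `a` to `b` in time `T`, with derivative `V`, extended by constants. -/
structure IsProfile (W V : ℝ → Plane) (T : ℝ) (a b : Plane) : Prop where
  pos : 0 < T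
  continuous : Continuous W
  hasDerivAt : ∀ s, s ≠ 0 → s ≠ T → HasDerivAt W (V s) s
  measurable : Measurable V
  bounded : ∃ K, ∀ s, ‖V s‖ ≤ K
  deriv_eq_zero : ∀ s, s ∉ Ioo 0 T → V s = 0
  eq_left : ∀ s ≤ 0, W s = a
  eq_right : ∀ s, T ≤ s → W s = b

/-- The scale-free energy density of a profile. -/
def profileDensity (c : ℝ) (W V : ℝ → Plane) (s : ℝ) : ℝ := 1 / 2 * ‖V s‖ ^ 2 + bulkNonneg c (W s)

theorem IsProfile.intervalIntegrable_profileDensity {W V : ℝ → Plane} {T : ℝ} {a b : Plane}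
    (h : IsProfile W V T a b) (c x y : ℝ) :
    IntervalIntegrable (profileDensity c W V) volume x y := by
  obtain ⟨K, hK⟩ := h.bounded
  refine IntervalIntegrable.add (IntervalIntegrable.const_mul ?_ _)
    (((continuous_bulkNonneg c).comp h.continuous).intervalIntegrable _ _)
  refine (intervalIntegrable_const (c := K ^ 2)).mono_fun
    (h.measurable.norm.pow_const 2).aestronglyMeasurable (Eventually.of_forall fun s => ?_)
  simp only [norm_pow, Real.norm_eq_abs, abs_norm]
  exact pow_le_pow_left₀ (norm_nonneg _) ((hK s).trans (le_abs_self _)) 2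

/-- Resting at a zero of the potential costs nothing, so a layer may be prolonged to any later time.
-/
theorem IsProfile.integral_profileDensity_eq {W V : ℝ → Plane} {T : ℝ} {a b : Plane}
    (h : IsProfile W V T a b) {c : ℝ} (hb : bulkNonneg c b = 0) {R : ℝ} (hR : T ≤ R) :
    ∫ s in (0 : ℝ)..R, profileDensity c W V s = ∫ s in (0 : ℝ)..T, profileDensity c W V s := by
  rw [← intervalIntegral.integral_add_adjacent_intervals
    (h.intervalIntegrable_profileDensity c 0 T) (h.intervalIntegrable_profileDensity c T R)]
  rw [intervalIntegral.integral_congr (a := T) (g := fun _ => 0), intervalIntegral.integral_zero,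
    add_zero]
  intro s hs
  rw [uIcc_of_le hR] at hs
  simp only [profileDensity]
  rw [h.deriv_eq_zero s (fun h' => (not_lt.2 hs.1) h'.2), h.eq_right s hs.1, hb]
  simp

/-- Pointwise near-equality in the inequality between arithmetic and geometric mean. -/
theorem density_le_of_speed_eq {x y δ : ℝ} (hx : 0 ≤ x) (hy : 0 ≤ y) (hδ : 0 < δ) :
    (1 / 2 * (((x + δ) / (Real.sqrt 2 * (y + δ)))⁻¹ * x) ^ 2 + y ^ 2) *
      ((x + δ) / (Real.sqrt 2 * (y + δ))) ≤ Real.sqrt 2 * (y * x) + δ * (x + y) := by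
  have hs2 : 0 < Real.sqrt 2 := by positivity
  have hs2sq : Real.sqrt 2 ^ 2 = 2 := Real.sq_sqrt (by norm_num)
  have hxδ : 0 < x + δ := by linarith
  have hyδ : 0 < y + δ := by linarith
  -- With `x` the speed of the curve and `y` the weight, equipartition asks for new speed `√2 y`,
  -- that is, for the time change `σ = x / (√2 y)`. The two `δ` keep `σ` positive and finite where
  -- the curve stops or the weight vanishes. Each half of the energy then contributes about `√2 xy /
  -- 2`.
  set σ := (x + δ) / (Real.sqrt 2 * (y + δ)) with hσ
  have hσ0 : 0 < σ := by positivity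
  have e : (1 / 2 * (σ⁻¹ * x) ^ 2 + y ^ 2) * σ = 1 / 2 * x ^ 2 * σ⁻¹ + y ^ 2 * σ := by
    field_simp
  have b1 : 1 / 2 * x ^ 2 * σ⁻¹ ≤ Real.sqrt 2 / 2 * (x * (y + δ)) := by
    rw [hσ, inv_div, mul_div_assoc', div_le_iff₀ hxδ]
    have : 0 ≤ Real.sqrt 2 / 2 * (x * (y + δ)) * δ := by positivity
    nlinarith
  have b2 : y ^ 2 * σ ≤ Real.sqrt 2 / 2 * (y * (x + δ)) := by
    rw [hσ, mul_div_assoc', div_le_iff₀ (by positivity)]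
    have e4 : Real.sqrt 2 / 2 * (y * (x + δ)) * (Real.sqrt 2 * (y + δ)) =
        Real.sqrt 2 ^ 2 / 2 * (y * (x + δ)) * (y + δ) := by ring
    rw [e4, hs2sq]
    have : 0 ≤ y * (x + δ) * δ := by positivity
    nlinarith
  have h2le : Real.sqrt 2 / 2 ≤ 1 := by nlinarith [sq_nonneg (Real.sqrt 2 - 2)]
  have : Real.sqrt 2 / 2 * (δ * (x + y)) ≤ δ * (x + y) :=
    mul_le_of_le_one_left (by positivity) h2le
  rw [e]
  linarith

/-- Curves of almost minimal length can be reparametrised with almost equipartition of energy. -/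
theorem exists_isProfile {c : ℝ} (hc : 0 < c) (a b : Plane) {ε : ℝ} (hε : 0 < ε) :
    ∃ (W V : ℝ → Plane) (T : ℝ), IsProfile W V T a b ∧
      ∫ s in (0 : ℝ)..T, profileDensity c W V s ≤ Real.sqrt 2 * geoDist c a b + ε := by
  have h11 : (-1 : ℝ) ≤ 1 := by norm_num
  have hs2 : 0 < Real.sqrt 2 := by positivity
  have hs2sq : Real.sqrt 2 ^ 2 = 2 := Real.sq_sqrt (by norm_num)
  obtain ⟨γ, hγ, hγa, hγb, hlen⟩ := exists_weightedLength_lt c a b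
    (show 0 < ε / (2 * Real.sqrt 2) by positivity)
  set d := derivWithin γ (Icc (-1) 1) with hd
  have hdc : ContinuousOn d (Icc (-1) 1) :=
    hγ.continuousOn_derivWithin (uniqueDiffOn_Icc (by norm_num)) le_rfl
  -- Clamping to `[-1, 1]` turns the curve and its one-sided derivative into continuous functions on
  -- the line.
  set cl : ℝ → ℝ := fun t => max (-1) (min t 1) with hcl
  have hclc : Continuous cl := by fun_prop
  have hclm : ∀ t, cl t ∈ Icc (-1 : ℝ) 1 := fun t =>
    ⟨le_max_left _ _, max_le h11 (min_le_right _ _)⟩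
  have hcli : ∀ t ∈ Icc (-1 : ℝ) 1, cl t = t := fun t ht => by
    simp only [hcl]; rw [min_eq_left ht.2, max_eq_right ht.1]
  have hγe : Continuous fun t => γ (cl t) := hγ.continuousOn.comp_continuous hclc hclm
  have hde : Continuous fun t => d (cl t) := hdc.comp_continuous hclc hclm
  set F : ℝ → ℝ := fun t => Real.sqrt (bulkNonneg c (γ (cl t))) with hF
  have hFc : Continuous F := ((continuous_bulkNonneg c).comp hγe).sqrt
  have hF0 : ∀ t, 0 ≤ F t := fun t => Real.sqrt_nonneg _
  have hFsq : ∀ t, bulkNonneg c (γ (cl t)) = F t ^ 2 := fun t =>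
    (Real.sq_sqrt (bulkNonneg_nonneg hc _)).symm
  obtain ⟨B, hB⟩ := isCompact_Icc.exists_bound_of_continuousOn
    (s := Icc (-1 : ℝ) 1) hFc.continuousOn
  have hFB : ∀ t, F t ≤ |B| := fun t => by
    have h1 := hB (cl t) (hclm t)
    have h2 : F (cl t) = F t := by simp only [hF, hcli _ (hclm t)]
    rw [h2] at h1
    exact (le_abs_self _).trans (h1.trans (le_abs_self _))
  set A := ∫ t in (-1 : ℝ)..1, (‖d (cl t)‖ + F t) with hA
  have hA0 : 0 ≤ A := intervalIntegral.integral_nonneg h11 fun t _ =>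
    add_nonneg (norm_nonneg _) (hF0 t)
  -- Makes the regularisation error `δ A` at most `ε / 2`. The other half of `ε` is `√2` times the
  -- excess allowed in the choice of `γ`.
  set δ := ε / (2 * (A + 1)) with hδ
  have hδ0 : 0 < δ := by positivity
  set σ : ℝ → ℝ := fun t => (‖d (cl t)‖ + δ) / (Real.sqrt 2 * (F t + δ)) with hσ
  have hFδ : ∀ t, 0 < F t + δ := fun t => add_pos_of_nonneg_of_pos (hF0 t) hδ0
  have hσ0 : ∀ t, 0 < σ t := fun t =>
    div_pos (add_pos_of_nonneg_of_pos (norm_nonneg _) hδ0) (mul_pos hs2 (hFδ t))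
  have hσc : Continuous σ :=
    (hde.norm.add continuous_const).div (continuous_const.mul (hFc.add continuous_const))
      fun t => (mul_pos hs2 (hFδ t)).ne'
  have hσi : ∀ x y, IntervalIntegrable σ volume x y := fun x y => hσc.intervalIntegrable _ _
  -- A uniform lower bound for the speed of the time change `S`. It makes `S` a bijection of the
  -- whole line, so that its inverse `τ` is global.
  set s0 := δ / (Real.sqrt 2 * (|B| + δ)) with hs0
  have hs00 : 0 < s0 := by positivity
  have hσlow : ∀ t, s0 ≤ σ t := fun t => by
    refine div_le_div₀ (by positivity) (by linarith [norm_nonneg (d (cl t))])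
      (mul_pos hs2 (hFδ t)) ?_
    have := hFB t
    gcongr
  set S : ℝ → ℝ := fun t => ∫ x in (-1 : ℝ)..t, σ x with hS
  have hSd : ∀ t, HasDerivAt S (σ t) t := fun t =>
    intervalIntegral.integral_hasDerivAt_right (hσi _ _)
      hσc.stronglyMeasurable.stronglyMeasurableAtFilter hσc.continuousAt
  have hSc : Continuous S := continuous_iff_continuousAt.2 fun t => (hSd t).continuousAt
  have hSmono : StrictMono S := strictMono_of_hasDerivAt_pos hSd hσ0
  have hSlow : Monotone fun t => S t - s0 * t :=
    monotone_of_hasDerivAt_nonneg (f' := fun t => σ t - s0 * 1)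
      (fun t => (hSd t).sub ((hasDerivAt_id t).const_mul s0))
      (fun t => by have := hσlow t; simp only [Pi.zero_apply]; linarith)
  have hS1 : S (-1) = 0 := by simp [hS]
  have hStop : Tendsto S atTop atTop := by
    refine tendsto_atTop_mono' _ (f₁ := fun t => s0 * t + s0) ?_
      (tendsto_atTop_add_const_right _ _ (tendsto_id.const_mul_atTop hs00))
    filter_upwards [eventually_ge_atTop (-1)] with t ht
    have := hSlow ht
    simp only [hS1] at this
    linarith
  have hSbot : Tendsto S atBot atBot := by
    refine tendsto_atBot_mono' _ (f₁ := fun t => s0 * t + s0) (f₂ := S) ?_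
      (tendsto_atBot_add_const_right _ _ (tendsto_id.const_mul_atBot hs00))
    filter_upwards [eventually_le_atBot (-1)] with t ht
    have := hSlow ht
    simp only [hS1] at this
    linarith
  have hSsurj : Function.Surjective S := hSc.surjective hStop hSbot
  set Φ := hSmono.orderIsoOfSurjective S hSsurj with hΦ
  set τ : ℝ → ℝ := fun s => Φ.symm s with hτ
  have hτc : Continuous τ := Φ.symm.continuous
  have hτS : ∀ t, τ (S t) = t := fun t => Φ.symm_apply_apply t
  have hSτ : ∀ s, S (τ s) = s := fun s => Φ.apply_symm_apply s
  have hτmono : StrictMono τ := Φ.symm.strictMono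
  have hτd : ∀ s, HasDerivAt τ (σ (τ s))⁻¹ s := fun s =>
    HasDerivAt.of_local_left_inverse hτc.continuousAt (hSd _) (hσ0 _).ne'
      (Eventually.of_forall hSτ)
  set T := S 1 with hT
  have hT0 : 0 < T := by rw [← hS1]; exact hSmono (by norm_num)
  have hτ0 : τ 0 = -1 := by rw [← hS1, hτS]
  have hτT : τ T = 1 := hτS 1
  set v : ℝ → Plane := fun s => (σ (τ s))⁻¹ • d (cl (τ s)) with hv
  have hvc : Continuous v := by
    refine Continuous.smul (Continuous.inv₀ (hσc.comp hτc) fun s => (hσ0 _).ne') (hde.comp hτc)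
  set W : ℝ → Plane := fun s => γ (cl (τ s)) with hW
  have hWc : Continuous W := hγe.comp hτc
  -- The cut-off is needed: outside `(0, T)` the clamped `v` keeps the direction of the end
  -- derivative, while `W` is constant.
  set V : ℝ → Plane := (Ioo 0 T).indicator v with hV
  have hWl : ∀ s ≤ 0, W s = a := fun s hs => by
    have : τ s ≤ -1 := hτ0 ▸ hτmono.monotone hs
    simp only [hW, hcl]
    rw [min_eq_left (this.trans h11), max_eq_left this, hγa]
  have hWr : ∀ s, T ≤ s → W s = b := fun s hs => by
    have : 1 ≤ τ s := hτT ▸ hτmono.monotone hs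
    simp only [hW, hcl]
    rw [min_eq_right this, max_eq_right h11, hγb]
  refine ⟨W, V, T, ⟨hT0, hWc, ?_, ?_, ?_, ?_, hWl, hWr⟩, ?_⟩
  · intro s hs0' hsT
    rcases lt_or_gt_of_ne hs0' with h | h
    · have e : W =ᶠ[𝓝 s] fun _ => a := by
        filter_upwards [Iio_mem_nhds h] with z hz using hWl z (le_of_lt hz)
      rw [hV, indicator_of_notMem (fun h' => (lt_asymm h h'.1))]
      exact (hasDerivAt_const s a).congr_of_eventuallyEq e
    rcases lt_or_gt_of_ne hsT with h' | h'
    · have hmem : τ s ∈ Ioo (-1 : ℝ) 1 := ⟨hτ0 ▸ hτmono h, hτT ▸ hτmono h'⟩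
      rw [hV, indicator_of_mem (show s ∈ Ioo 0 T from ⟨h, h'⟩)]
      have hγd : HasDerivAt γ (d (τ s)) (τ s) :=
        ((hγ.differentiableOn one_ne_zero _ (Ioo_subset_Icc_self hmem)).hasDerivWithinAt).hasDerivAt
          (Icc_mem_nhds hmem.1 hmem.2)
      have h3 := HasDerivAt.scomp s hγd (hτd s)
      simp only [hv, hcli _ (Ioo_subset_Icc_self hmem)]
      refine h3.congr_of_eventuallyEq ?_
      filter_upwards [Ioo_mem_nhds h h'] with z hz
      have : τ z ∈ Icc (-1 : ℝ) 1 :=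
        ⟨hτ0 ▸ hτmono.monotone hz.1.le, hτT ▸ hτmono.monotone hz.2.le⟩
      simp only [hW, hcli _ this, Function.comp]
    · have e : W =ᶠ[𝓝 s] fun _ => b := by
        filter_upwards [Ioi_mem_nhds h'] with z hz using hWr z (le_of_lt hz)
      rw [hV, indicator_of_notMem (fun h'' => (lt_asymm h' h''.2))]
      exact (hasDerivAt_const s b).congr_of_eventuallyEq e
  · exact hvc.measurable.indicator measurableSet_Ioo
  · obtain ⟨K, hK⟩ := isCompact_Icc.exists_bound_of_continuousOn (s := Icc 0 T) hvc.continuousOn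
    refine ⟨|K|, fun s => ?_⟩
    by_cases hs : s ∈ Ioo 0 T
    · rw [hV, indicator_of_mem hs]
      exact (hK s (Ioo_subset_Icc_self hs)).trans (le_abs_self _)
    · rw [hV, indicator_of_notMem hs, norm_zero]; exact abs_nonneg _
  · intro s hs
    exact indicator_of_notMem hs _
  · have e1 : ∫ s in (0 : ℝ)..T, profileDensity c W V s =
        ∫ s in (0 : ℝ)..T, profileDensity c W v s := by
      rw [intervalIntegral.integral_of_le hT0.le, intervalIntegral.integral_of_le hT0.le,
        integral_Ioc_eq_integral_Ioo, integral_Ioc_eq_integral_Ioo]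
      refine setIntegral_congr_fun measurableSet_Ioo fun s hs => ?_
      simp only [profileDensity, hV, indicator_of_mem hs]
    have hgc : Continuous (profileDensity c W v) := by
      unfold profileDensity
      exact (continuous_const.mul (hvc.norm.pow 2)).add ((continuous_bulkNonneg c).comp hWc)
    have e2 := intervalIntegral.integral_comp_mul_deriv (a := -1) (b := 1)
      (fun x _ => hSd x) hσc.continuousOn hgc
    rw [hS1] at e2
    rw [e1, ← e2]
    have hwl : weightedLength c γ = ∫ t in (-1 : ℝ)..1, F t * ‖d (cl t)‖ := by
      rw [weightedLength_eq]
      refine intervalIntegral.integral_congr fun t ht => ?_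
      rw [uIcc_of_le h11] at ht
      simp only [lengthDensity, hF, hcli t ht, hd]
    have hi1 : IntervalIntegrable (fun t => Real.sqrt 2 * (F t * ‖d (cl t)‖)) volume (-1) 1 :=
      (continuous_const.mul (hFc.mul hde.norm)).intervalIntegrable _ _
    have hi2 : IntervalIntegrable (fun t => δ * (‖d (cl t)‖ + F t)) volume (-1) 1 :=
      (continuous_const.mul (hde.norm.add hFc)).intervalIntegrable _ _
    calc ∫ t in (-1 : ℝ)..1, (profileDensity c W v ∘ S) t * σ t
        ≤ ∫ t in (-1 : ℝ)..1, (Real.sqrt 2 * (F t * ‖d (cl t)‖) + δ * (‖d (cl t)‖ + F t)) := by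
          refine intervalIntegral.integral_mono_on h11
            (((hgc.comp hSc).mul hσc).intervalIntegrable _ _) (hi1.add hi2) fun t _ => ?_
          have hσt := hσ0 t
          simp only [Function.comp, profileDensity, hW, hv, hτS, hFsq, norm_smul, norm_inv,
            Real.norm_eq_abs, abs_of_pos hσt]
          exact density_le_of_speed_eq (norm_nonneg _) (hF0 t) hδ0
      _ = Real.sqrt 2 * weightedLength c γ + δ * A := by
          rw [intervalIntegral.integral_add hi1 hi2, intervalIntegral.integral_const_mul,
            intervalIntegral.integral_const_mul, hwl]
      _ ≤ Real.sqrt 2 * (geoDist c a b + ε / (2 * Real.sqrt 2)) + ε / 2 := by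
          refine add_le_add (mul_le_mul_of_nonneg_left hlen.le hs2.le) ?_
          rw [hδ, div_mul_eq_mul_div, div_le_div_iff₀ (by positivity) two_pos]
          nlinarith
      _ = _ := by field_simp; ring

/-- A continuous, piecewise `C¹` map with bounded derivative satisfying the boundary conditions is
admissible. -/
def AdmissibleMap.ofHasDerivAt (u g : ℝ → Plane) (s : Set ℝ) (hs : s.Countable) (hu : Continuous u)
    (hd : ∀ y, y ∉ s → HasDerivAt u (g y) y) (hg : Measurable g) (hb : ∃ K, ∀ y, ‖g y‖ ≤ K)
    (hl : u (-1) = pbLeft) (hr : u 1 = pbRight) : AdmissibleMap where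
  toFun := u
  wderiv := g
  continuousOn := hu.continuousOn
  memLp := by
    obtain ⟨K, hK⟩ := isCompact_Icc.exists_bound_of_continuousOn (s := Icc (-1 : ℝ) 1)
      hu.continuousOn
    refine MemLp.of_bound hu.aestronglyMeasurable K ?_
    filter_upwards [ae_restrict_mem measurableSet_Ioo] with y hy using hK y (Ioo_subset_Icc_self hy)
  memLp_wderiv := by
    obtain ⟨K, hK⟩ := hb
    exact MemLp.of_bound hg.aestronglyMeasurable K (Eventually.of_forall hK)
  isWeakDeriv := by
    intro φ hφ _ hsupp
    have h11 : (-1 : ℝ) ≤ 1 := by norm_num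
    obtain ⟨K, hK⟩ := hb
    have hφc := hφ.continuous
    have hφd : Continuous (deriv φ) := hφ.continuous_deriv (by simp)
    have i1 : IntervalIntegrable (fun y => deriv φ y • u y) volume (-1) 1 :=
      (hφd.smul hu).intervalIntegrable _ _
    have i0 : IntervalIntegrable g volume (-1) 1 :=
      (intervalIntegrable_const (c := K)).mono_fun hg.aestronglyMeasurable
        (Eventually.of_forall fun y => (hK y).trans (le_abs_self _))
    have i2 : IntervalIntegrable (fun y => φ y • g y) volume (-1) 1 :=
      i0.continuousOn_smul hφc.continuousOn
    have hz : ∀ y, y ∉ Ioo (-1 : ℝ) 1 → φ y = 0 := fun y hy =>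
      image_eq_zero_of_notMem_tsupport fun h => hy (hsupp h)
    -- Integration by parts: the derivative of `φ u` has integral zero, since `φ` vanishes at `±1`
    -- and the corners in `s` are countable.
    have key := integral_eq_of_hasDerivAt_off_countable_of_le (fun y => φ y • u y)
      (fun y => φ y • g y + deriv φ y • u y) h11 hs (hφc.smul hu).continuousOn
      (fun y hy => ((hφ.differentiable (by simp)).differentiableAt.hasDerivAt).smul (hd y hy.2))
      (i2.add i1)
    rw [intervalIntegral.integral_add i2 i1, hz 1 (by simp), hz (-1) (by simp), zero_smul,
      zero_smul, sub_zero, intervalIntegral.integral_of_le h11, intervalIntegral.integral_of_le h11,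
      integral_Ioc_eq_integral_Ioo, integral_Ioc_eq_integral_Ioo] at key
    exact eq_neg_of_add_eq_zero_right key
  left_eq := hl
  right_eq := hr

/-- Two profiles ending in a common zero of the potential, put as boundary layers at `-1` and `1`,
form an admissible map. -/
theorem exists_energy_eq_of_isProfile {c l : ℝ} (hl : 0 < l) {j : Plane} (hj : bulkNonneg c j = 0)
    {W₁ V₁ W₂ V₂ : ℝ → Plane} {T₁ T₂ : ℝ} (h₁ : IsProfile W₁ V₁ T₁ pbLeft j)
    (h₂ : IsProfile W₂ V₂ T₂ pbRight j) (hT₁ : T₁ ≤ (Real.sqrt l)⁻¹) (hT₂ : T₂ ≤ (Real.sqrt l)⁻¹) :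
    ∃ q : AdmissibleMap, energy c l q =
      (∫ s in (0 : ℝ)..T₁, profileDensity c W₁ V₁ s) +
        ∫ s in (0 : ℝ)..T₂, profileDensity c W₂ V₂ s := by
  set N := (Real.sqrt l)⁻¹ with hN
  have hsl := Real.sqrt_pos.2 hl
  have hN0 : 0 < N := inv_pos.2 hsl
  obtain ⟨K₁, hK₁⟩ := h₁.bounded
  obtain ⟨K₂, hK₂⟩ := h₂.bounded
  have hNinv : Real.sqrt l = N⁻¹ := by rw [hN, inv_inv]
  -- The second layer runs backwards from `y = 1`. Since `T₁, T₂ ≤ N`, on each half of the interval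
  -- the opposite layer has already reached `j`, and subtracting `j` leaves a single profile.
  set u : ℝ → Plane := fun y => W₁ (N * y + N) + W₂ (-N * y + N) - j with hu
  set g : ℝ → Plane := fun y => N • V₁ (N * y + N) + (-N) • V₂ (-N * y + N) with hg
  have huc : Continuous u := by
    have := h₁.continuous
    have := h₂.continuous
    fun_prop
  have hgm : Measurable g := by
    have := h₁.measurable
    have := h₂.measurable
    fun_prop
  -- The four exceptional points are where one of the rescaled times equals `0` or the duration of
  -- its profile.
  have hd : ∀ y, y ∉ ({-1, (T₁ - N) / N, 1, (N - T₂) / N} : Set ℝ) → HasDerivAt u (g y) y := by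
    intro y hy
    simp only [mem_insert_iff, mem_singleton_iff, not_or] at hy
    obtain ⟨y1, y2, y3, y4⟩ := hy
    have d1 := h₁.hasDerivAt (N * y + N)
      (fun h => y1 (by have : N * (y + 1) = 0 := by linarith
                       rcases mul_eq_zero.1 this with h | h <;> linarith))
      (fun h => y2 (by rw [eq_div_iff hN0.ne']; linarith))
    have d2 := h₂.hasDerivAt (-N * y + N)
      (fun h => y3 (by have : N * (1 - y) = 0 := by linarith
                       rcases mul_eq_zero.1 this with h | h <;> linarith))
      (fun h => y4 (by rw [eq_div_iff hN0.ne']; linarith))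
    have a1 : HasDerivAt (fun y : ℝ => N * y + N) N y := by
      simpa using ((hasDerivAt_id y).const_mul N).add_const N
    have a2 : HasDerivAt (fun y : ℝ => -N * y + N) (-N) y := by
      simpa using ((hasDerivAt_id y).const_mul (-N)).add_const N
    exact ((HasDerivAt.scomp y d1 a1).add (HasDerivAt.scomp y d2 a2)).sub_const j
  have hbd : ∀ y, ‖g y‖ ≤ N * K₁ + N * K₂ := fun y => by
    refine (norm_add_le _ _).trans ?_
    rw [norm_smul, norm_smul, norm_neg, Real.norm_eq_abs, abs_of_pos hN0]
    have := hK₁ (N * y + N)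
    have := hK₂ (-N * y + N)
    gcongr
  have hL : ∀ y ≤ 0, u y = W₁ (N * y + N) ∧ g y = N • V₁ (N * y + N) := fun y hy => by
    have : T₂ ≤ -N * y + N := by nlinarith
    simp only [hu, hg]
    rw [h₂.eq_right _ this, h₂.deriv_eq_zero _ (fun h => not_lt.2 this h.2)]
    simp
  have hR : ∀ y, 0 ≤ y → u y = W₂ (-N * y + N) ∧ g y = (-N) • V₂ (-N * y + N) := fun y hy => by
    have : T₁ ≤ N * y + N := by nlinarith
    simp only [hu, hg]
    rw [h₁.eq_right _ this, h₁.deriv_eq_zero _ (fun h => not_lt.2 this h.2)]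
    simp
  have hul : u (-1) = pbLeft := by
    rw [(hL _ (by norm_num)).1]; exact h₁.eq_left _ (by linarith)
  have hur : u 1 = pbRight := by
    rw [(hR _ (by norm_num)).1]; exact h₂.eq_left _ (by linarith)
  refine ⟨AdmissibleMap.ofHasDerivAt u g _ (Set.Finite.countable (by simp)) huc hd hgm
    ⟨_, hbd⟩ hul hur, ?_⟩
  set e : ℝ → ℝ := fun y => Real.sqrt l / 2 * g y 0 ^ 2 + Real.sqrt l / 2 * g y 1 ^ 2 +
      1 / Real.sqrt l * bulkNonneg c (u y) with he
  have hen : energy c l (AdmissibleMap.ofHasDerivAt u g _ (Set.Finite.countable (by simp)) huc hd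
      hgm ⟨_, hbd⟩ hul hur) = ∫ y in (-1 : ℝ)..1, e y := by
    rw [intervalIntegral.integral_of_le (by norm_num), integral_Ioc_eq_integral_Ioo]; rfl
  have heq : ∀ y, e y = N⁻¹ / 2 * ‖g y‖ ^ 2 + N * bulkNonneg c (u y) := fun y => by
    simp only [he, hNinv, norm_sq_eq]; rw [one_div, inv_inv]; ring
  have heL : ∀ y ≤ 0, e y = N * profileDensity c W₁ V₁ (N * y + N) := fun y hy => by
    rw [heq, (hL y hy).1, (hL y hy).2, norm_smul, Real.norm_eq_abs, abs_of_pos hN0, profileDensity]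
    field_simp
  have heR : ∀ y, 0 ≤ y → e y = N * profileDensity c W₂ V₂ (-N * y + N) := fun y hy => by
    rw [heq, (hR y hy).1, (hR y hy).2, norm_smul, norm_neg, Real.norm_eq_abs, abs_of_pos hN0,
      profileDensity]
    field_simp
  have hei : ∀ x y, IntervalIntegrable e volume x y := fun x y => by
    rw [funext heq]
    refine IntervalIntegrable.add (IntervalIntegrable.const_mul ?_ _)
      ((continuous_const.mul ((continuous_bulkNonneg c).comp huc)).intervalIntegrable _ _)
    refine (intervalIntegrable_const (c := (N * K₁ + N * K₂) ^ 2)).mono_fun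
      (hgm.norm.pow_const 2).aestronglyMeasurable (Eventually.of_forall fun s => ?_)
    simp only [norm_pow, Real.norm_eq_abs, abs_norm]
    exact pow_le_pow_left₀ (norm_nonneg _) ((hbd s).trans (le_abs_self _)) 2
  rw [hen, ← intervalIntegral.integral_add_adjacent_intervals (hei (-1) 0) (hei 0 1)]
  congr 1
  · rw [← h₁.integral_profileDensity_eq hj hT₁]
    have := intervalIntegral.smul_integral_comp_mul_add (a := -1) (b := 0)
      (profileDensity c W₁ V₁) N N
    rw [show N * -1 + N = 0 by ring, show N * 0 + N = N by ring, smul_eq_mul,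
      ← intervalIntegral.integral_const_mul] at this
    rw [← this]
    refine intervalIntegral.integral_congr fun y hy => ?_
    rw [uIcc_of_le (by norm_num)] at hy
    exact heL y hy.2
  · rw [← h₂.integral_profileDensity_eq hj hT₂]
    have := intervalIntegral.smul_integral_comp_mul_add (a := 0) (b := 1)
      (profileDensity c W₂ V₂) (-N) N
    rw [show -N * 0 + N = N by ring, show -N * 1 + N = 0 by ring, smul_eq_mul, neg_mul,
      intervalIntegral.integral_symm 0 N, neg_inj, ← intervalIntegral.integral_const_mul] at this
    rw [← this]
    refine intervalIntegral.integral_congr fun y hy => ?_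
    rw [uIcc_of_le (by norm_num)] at hy
    exact heR y hy.1

/-- The upper bound. Competitors close to a constant zero of the potential suffice, since interior
jumps never lower the limit cost. -/
theorem exists_forall_exists_energy_le {c : ℝ} (hc : 0 < c) {j : Plane} (hj : bulkNonneg c j = 0)
    {ε : ℝ} (hε : 0 < ε) : ∃ l₀ > 0, ∀ l, 0 < l → l < l₀ → ∃ q : AdmissibleMap,
      energy c l q ≤ Real.sqrt 2 * (geoDist c pbLeft j + geoDist c j pbRight) + ε := by
  obtain ⟨W₁, V₁, T₁, h₁, e₁⟩ := exists_isProfile hc pbLeft j (half_pos hε)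
  obtain ⟨W₂, V₂, T₂, h₂, e₂⟩ := exists_isProfile hc pbRight j (half_pos hε)
  have hTpos : 0 < max T₁ T₂ := lt_max_of_lt_left h₁.pos
  -- In the variable `y` a layer has width `T √l`. Below this threshold both widths are at most `1`,
  -- so each layer fits into its half of the interval.
  refine ⟨((max T₁ T₂)⁻¹) ^ 2, by positivity, fun l hl hl' => ?_⟩
  have hsl := Real.sqrt_pos.2 hl
  have hle : max T₁ T₂ ≤ (Real.sqrt l)⁻¹ := by
    rw [le_inv_comm₀ hTpos hsl]
    exact Real.sqrt_le_iff.2 ⟨by positivity, hl'.le⟩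
  obtain ⟨q, hq⟩ := exists_energy_eq_of_isProfile hl hj h₁ h₂ ((le_max_left _ _).trans hle)
    ((le_max_right _ _).trans hle)
  refine ⟨q, ?_⟩
  rw [hq, geoDist_comm c j]
  linarith

/-! ### Convergence of minimisers -/

/-- The triangle inequality and the local Lipschitz bound give joint continuity, which carries the
lower energy bound through pointwise limits. -/
theorem continuous_geoDist (c : ℝ) : Continuous fun x : Plane × Plane => geoDist c x.1 x.2 := by
  rw [continuous_iff_continuousAt]
  rintro ⟨a, b⟩
  obtain ⟨C, hC, h⟩ := exists_geoDist_le_mul_norm_sub c (max ‖a‖ ‖b‖ + 1)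
  have hb : ∀ᶠ x : Plane × Plane in 𝓝 (a, b),
      ‖geoDist c x.1 x.2 - geoDist c a b‖ ≤ C * ‖x.1 - a‖ + C * ‖x.2 - b‖ := by
    have e1 : ∀ᶠ x : Plane × Plane in 𝓝 (a, b), ‖x.1‖ < max ‖a‖ ‖b‖ + 1 :=
      (continuous_fst.norm.tendsto (a, b)).eventually_lt_const
        (lt_of_le_of_lt (le_max_left _ _) (lt_add_one _))
    have e2 : ∀ᶠ x : Plane × Plane in 𝓝 (a, b), ‖x.2‖ < max ‖a‖ ‖b‖ + 1 :=
      (continuous_snd.norm.tendsto (a, b)).eventually_lt_const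
        (lt_of_le_of_lt (le_max_right _ _) (lt_add_one _))
    filter_upwards [e1, e2] with x hx1 hx2
    have ha : ‖a‖ ≤ max ‖a‖ ‖b‖ + 1 := (le_max_left _ _).trans (lt_add_one _).le
    have hb : ‖b‖ ≤ max ‖a‖ ‖b‖ + 1 := (le_max_right _ _).trans (lt_add_one _).le
    have k1 := h x.1 a hx1.le ha
    have k2 := h x.2 b hx2.le hb
    have t1 := geoDist_triangle c x.1 a x.2
    have t2 := geoDist_triangle c a b x.2
    have t3 := geoDist_triangle c a x.1 b
    have t4 := geoDist_triangle c x.1 x.2 b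
    rw [geoDist_comm c b x.2] at t2
    rw [geoDist_comm c a x.1] at t3
    rw [Real.norm_eq_abs, abs_le]
    constructor <;> linarith
  rw [ContinuousAt, tendsto_iff_norm_sub_tendsto_zero]
  refine squeeze_zero' (Eventually.of_forall fun _ => norm_nonneg _) hb ?_
  have : Continuous fun x : Plane × Plane => C * ‖x.1 - a‖ + C * ‖x.2 - b‖ := by fun_prop
  simpa using this.tendsto (a, b)

/-- The two minimisers of the bulk potential, indexed by the sign of the second coordinate. -/
def well (c : ℝ) (i : Bool) : Plane := if i then pStar c else pStarStar c

theorem bulkNonneg_well {c : ℝ} (hc : 0 < c) (i : Bool) : bulkNonneg c (well c i) = 0 := by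
  cases i
  · exact bulkNonneg_pStarStar hc
  · exact bulkNonneg_pStar hc

theorem geoDist_well_of_ne (c : ℝ) {i j : Bool} (h : i ≠ j) :
    geoDist c (well c i) (well c j) = geoDist c (pStar c) (pStarStar c) := by
  cases i <;> cases j <;> simp_all [well, geoDist_comm c (pStarStar c) (pStar c)]

/-- The cost of the two boundary layers for a constant limit map. -/
def boundaryCost (c : ℝ) (v : Plane) : ℝ := geoDist c pbLeft v + geoDist c v pbRight

theorem IsMinimiser.eventually_energy_le {c : ℝ} (hc : 0 < c) {l : ℕ → ℝ} (hl : ∀ n, 0 < l n)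
    (hl0 : Tendsto l atTop (𝓝 0)) {p : ℕ → AdmissibleMap} (hp : ∀ n, IsMinimiser c (l n) (p n))
    (i : Bool) {ε : ℝ} (hε : 0 < ε) :
    ∀ᶠ n in atTop, energy c (l n) (p n) ≤ Real.sqrt 2 * boundaryCost c (well c i) + ε := by
  obtain ⟨l₀, h0, h⟩ := exists_forall_exists_energy_le hc (bulkNonneg_well hc i) hε
  filter_upwards [hl0.eventually_lt_const h0] with n hn
  obtain ⟨q, hq⟩ := h (l n) (hl n) hn
  exact (hp n q).trans hq

/-- The lower energy bound passes to the limit along any filter along which the energies are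
asymptotically minimal. -/
theorem geoDist_add_le_boundaryCost {c : ℝ} (hc : 0 < c) {l : ℕ → ℝ} (hl : ∀ n, 0 < l n)
    {q : ℕ → AdmissibleMap} {ℱ : Filter ℕ} [ℱ.NeBot] {i : Bool}
    (hE : ∀ ε > 0, ∀ᶠ n in ℱ, energy c (l n) (q n) ≤
      Real.sqrt 2 * boundaryCost c (well c i) + ε)
    {y₁ y₂ y₃ : ℝ} (h₁ : -1 ≤ y₁) (h₁₂ : y₁ ≤ y₂) (h₂₃ : y₂ ≤ y₃) (h₃ : y₃ ≤ 1)
    {v₁ v₂ v₃ : Plane} (t₁ : Tendsto (fun n => (q n).toFun y₁) ℱ (𝓝 v₁))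
    (t₂ : Tendsto (fun n => (q n).toFun y₂) ℱ (𝓝 v₂))
    (t₃ : Tendsto (fun n => (q n).toFun y₃) ℱ (𝓝 v₃)) :
    geoDist c pbLeft v₁ + geoDist c v₁ v₂ + geoDist c v₂ v₃ + geoDist c v₃ pbRight ≤
      boundaryCost c (well c i) := by
  have T : ∀ {f g : ℕ → Plane} {a b : Plane}, Tendsto f ℱ (𝓝 a) → Tendsto g ℱ (𝓝 b) →
      Tendsto (fun n => geoDist c (f n) (g n)) ℱ (𝓝 (geoDist c a b)) := by
    intro f g a b hf hg
    have h1 : Tendsto (fun n => (f n, g n)) ℱ (𝓝 (a, b)) := hf.prodMk_nhds hg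
    have h2 := ((continuous_geoDist c).tendsto (a, b)).comp h1
    simp only [Function.comp_def] at h2
    exact h2
  have hlim : Tendsto (fun n => Real.sqrt 2 * (geoDist c pbLeft ((q n).toFun y₁) +
      geoDist c ((q n).toFun y₁) ((q n).toFun y₂) + geoDist c ((q n).toFun y₂) ((q n).toFun y₃) +
      geoDist c ((q n).toFun y₃) pbRight)) ℱ (𝓝 (Real.sqrt 2 * (geoDist c pbLeft v₁ +
      geoDist c v₁ v₂ + geoDist c v₂ v₃ + geoDist c v₃ pbRight))) :=
    ((((T tendsto_const_nhds t₁).add (T t₁ t₂)).add (T t₂ t₃)).add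
      (T t₃ tendsto_const_nhds)).const_mul (Real.sqrt 2)
  have hs2 : 0 < Real.sqrt 2 := by positivity
  refine le_of_mul_le_mul_left (le_of_forall_pos_le_add fun ε hε => ?_) hs2
  refine le_of_tendsto hlim ((hE ε hε).mono fun n hn => ?_)
  exact ((q n).sqrt_two_mul_geoDist_le_energy hc (hl n) h₁ h₁₂ h₂₃ h₃).trans hn

/-- If the first and last values agree, jumps only add cost. Otherwise there is at least one jump,
and its cost `d(p*, p**)` pays for replacing the last value by the first in the right boundary term.
-/
theorem boundaryCost_value_le_J {c : ℝ} (P : TwoPhasePartition c) :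
    boundaryCost c (P.value 0) ≤ P.J := by
  have hκ := geoDist_nonneg c (pStar c) (pStarStar c)
  have hsum : (∑ _j : Fin P.jumps, geoDist c (pStar c) (pStarStar c)) =
      P.jumps * geoDist c (pStar c) (pStarStar c) := by simp
  rw [boundaryCost, TwoPhasePartition.J, hsum, geoDist_comm c pbLeft]
  by_cases h : P.value 0 = P.value (Fin.last P.jumps)
  · rw [← h]
    have : 0 ≤ (P.jumps : ℝ) * geoDist c (pStar c) (pStarStar c) := by positivity
    linarith
  · have h1 : (1 : ℝ) ≤ P.jumps := by
      rw [Nat.one_le_cast, Nat.one_le_iff_ne_zero]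
      intro h0
      apply h
      congr 1
      apply Fin.ext
      simp [h0]
    have h2 : geoDist c (P.value 0) (P.value (Fin.last P.jumps)) =
        geoDist c (pStar c) (pStarStar c) := by
      rcases P.value_mem 0 with h3 | h3 <;> rcases P.value_mem (Fin.last P.jumps) with h4 | h4
      · exact absurd (h3.trans h4.symm) h
      · rw [h3, h4]
      · rw [h3, h4, geoDist_comm]
      · exact absurd (h3.trans h4.symm) h
    have h3 := geoDist_triangle c (P.value 0) (P.value (Fin.last P.jumps)) pbRight
    rw [h2] at h3
    nlinarith

/-- The partition with at most one jump, at `t`, from `well c i` to `well c j`. -/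
theorem exists_twoPhasePartition {c : ℝ} (hc : 0 < c) {t : ℝ} (ht : t ∈ Ioo (-1 : ℝ) 1)
    (i j : Bool) : ∃ P : TwoPhasePartition c,
      (∀ y ∈ Ioo (-1 : ℝ) 1, y ≠ t → P.map y = if y < t then well c i else well c j) ∧
      P.J ≤ geoDist c pbLeft (well c i) + geoDist c (well c i) (well c j) +
        geoDist c (well c j) pbRight := by
  have hmem : ∀ i, well c i = pStar c ∨ well c i = pStarStar c := fun i => by
    cases i
    · exact Or.inr rfl
    · exact Or.inl rfl
  -- Neighbouring values of a partition must differ, so `i = j` requires the partition without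
  -- jumps.
  by_cases hij : i = j
  · subst hij
    refine ⟨{ jumps := 0
              pt := ![-1, 1]
              pt_strictMono := by
                rw [Fin.strictMono_iff_lt_succ]
                intro k
                fin_cases k
                norm_num
              pt_zero := rfl
              pt_last := rfl
              value := fun _ => well c i
              value_mem := fun _ => hmem i
              value_ne := fun k => k.elim0 }, fun y hy _ => ?_, ?_⟩
    · rw [ite_self]
      refine (Fin.sum_univ_one _).trans ?_
      show (Ico (-1 : ℝ) 1 ∩ Ioo (-1) 1).indicator (fun _ => well c i) y = _
      exact indicator_of_mem (mem_inter (mem_Ico.2 ⟨hy.1.le, hy.2⟩) hy) _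
    · simp only [TwoPhasePartition.J, Finset.univ_eq_empty, Finset.sum_empty]
      rw [geoDist_comm c pbLeft]
      linarith [geoDist_nonneg c (well c i) (well c i)]
  · have hne : well c i ≠ well c j := by
      have := pStar_ne_pStarStar hc
      cases i <;> cases j <;> simp_all [well, this.symm]
    refine ⟨{ jumps := 1
              pt := ![-1, t, 1]
              pt_strictMono := by
                rw [Fin.strictMono_iff_lt_succ]
                intro k
                fin_cases k
                · exact ht.1
                · exact ht.2
              pt_zero := rfl
              pt_last := rfl
              value := ![well c i, well c j]
              value_mem := fun k => by
                fin_cases k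
                · exact hmem i
                · exact hmem j
              value_ne := fun k => by
                fin_cases k
                exact hne }, fun y hy hyt => ?_, ?_⟩
    · refine (Fin.sum_univ_two _).trans ?_
      show (Ico (-1 : ℝ) t ∩ Ioo (-1) 1).indicator (fun _ => well c i) y +
        (Ico t 1 ∩ Ioo (-1) 1).indicator (fun _ => well c j) y = _
      split_ifs with h
      · rw [indicator_of_mem (mem_inter (mem_Ico.2 ⟨hy.1.le, h⟩) hy),
          indicator_of_notMem (fun h' => not_le.2 h h'.1.1), add_zero]
      · rw [indicator_of_notMem (fun h' => h h'.1.2),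
          indicator_of_mem (mem_inter (mem_Ico.2 ⟨not_lt.1 h, hy.2⟩) hy), zero_add]
    · rw [geoDist_well_of_ne c hij]
      simp only [TwoPhasePartition.J, Finset.sum_const, Finset.card_univ, Fintype.card_fin,
        one_smul]
      show geoDist c (pStar c) (pStarStar c) + geoDist c (well c i) pbLeft +
        geoDist c (well c j) pbRight ≤ _
      rw [geoDist_comm c pbLeft]
      linarith

/-- A two-valued function on a set without alternating triples switches at most once. -/
theorem exists_switch_of_no_alternation {D : Set ℝ} (hD : D ⊆ Ioo (-1) 1) (σ : ℝ → Bool)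
    (h : ∀ x ∈ D, ∀ y ∈ D, ∀ z ∈ D, x < y → y < z → σ x = σ z → σ y = σ x) :
    ∃ t ∈ Ioo (-1 : ℝ) 1, ∃ i j, (∀ y ∈ D, y < t → σ y = i) ∧ (∀ y ∈ D, t < y → σ y = j) := by
  by_cases hconst : ∃ x ∈ D, ∃ z ∈ D, x < z ∧ σ x ≠ σ z
  · obtain ⟨x, hx, z, hz, hxz, hne⟩ := hconst
    have two : ∀ {a b d : Bool}, a ≠ b → d ≠ a → d = b := by decide
    -- The switch is placed at the supremum of the points carrying the first value. Beyond `z` there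
    -- are none, since `x, z, y` would alternate.
    set A := {y ∈ D | σ y = σ x} with hA
    have hAz : ∀ y ∈ A, y ≤ z := by
      rintro y ⟨hy, hyx⟩
      by_contra! hzy
      exact hne (h x hx z hz y hy hxz hzy hyx.symm).symm
    have hbdd : BddAbove A := ⟨z, hAz⟩
    have hxA : x ∈ A := ⟨hx, rfl⟩
    have h1 : x ≤ sSup A := le_csSup hbdd hxA
    have h2 : sSup A ≤ z := csSup_le ⟨x, hxA⟩ hAz
    refine ⟨sSup A, ⟨(hD hx).1.trans_le h1, h2.trans_lt (hD hz).2⟩, σ x, σ z, ?_, ?_⟩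
    · intro y hy hyt
      by_contra hyx
      have hyz : σ y = σ z := two hne hyx
      obtain ⟨w, hw, hyw⟩ := exists_lt_of_lt_csSup ⟨x, hxA⟩ hyt
      rcases lt_trichotomy y x with hlt | heq | hlt
      · exact hne ((h y hy x hx z hz hlt hxz hyz).trans hyz)
      · exact hyx (by rw [heq])
      · exact hyx (h x hx y hy w hw.1 hlt hyw hw.2.symm)
    · intro y hy hyt
      exact two hne fun hyx => not_le.2 hyt (le_csSup hbdd ⟨hy, hyx⟩)
  · push Not at hconst
    by_cases hne : D.Nonempty
    · obtain ⟨x, hx⟩ := hne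
      have hall : ∀ y ∈ D, σ y = σ x := fun y hy => by
        rcases lt_trichotomy y x with hlt | heq | hlt
        · exact hconst y hy x hx hlt
        · rw [heq]
        · exact (hconst x hx y hy hlt).symm
      exact ⟨0, by norm_num, σ x, σ x, fun y hy _ => hall y hy, fun y hy _ => hall y hy⟩
    · exact ⟨0, by norm_num, true, true, fun y hy => (hne ⟨y, hy⟩).elim,
        fun y hy => (hne ⟨y, hy⟩).elim⟩

/-- Almost everywhere convergence upgrades to convergence in `L¹` under domination by a constant
plus a sequence tending to zero in `L¹`. -/
theorem tendsto_eLpNorm_one_of_norm_le {μ : Measure ℝ} [IsFiniteMeasure μ] {h : ℕ → ℝ → Plane}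
    {f : ℕ → ℝ → ℝ} {K : ℝ} (hK : 0 ≤ K) (hm : ∀ k, AEStronglyMeasurable (h k) μ)
    (hf : ∀ k, Integrable (f k) μ) (hf0 : Tendsto (fun k => ∫ y, f k y ∂μ) atTop (𝓝 0))
    (hle : ∀ k, ∀ᵐ y ∂μ, ‖h k y‖ ≤ K + f k y) (hnn : ∀ k y, 0 ≤ f k y)
    (hlim : ∀ᵐ y ∂μ, Tendsto (fun k => h k y) atTop (𝓝 0)) :
    Tendsto (fun k => eLpNorm (h k) 1 μ) atTop (𝓝 0) := by
  have hmin : Tendsto (fun k => ∫ y, min ‖h k y‖ K ∂μ) atTop (𝓝 (∫ _, (0 : ℝ) ∂μ)) := by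
    refine tendsto_integral_of_dominated_convergence (fun _ => K)
      (fun k => (hm k).norm.inf aestronglyMeasurable_const) (integrable_const K)
      (fun k => Eventually.of_forall fun y => ?_) ?_
    · rw [Real.norm_eq_abs, abs_of_nonneg (le_min (norm_nonneg _) hK)]
      exact min_le_right _ _
    · filter_upwards [hlim] with y hy
      have := hy.norm.min (tendsto_const_nhds (x := K))
      simpa [min_eq_left hK] using this
  rw [integral_zero] at hmin
  have hmini : ∀ k, Integrable (fun y => min ‖h k y‖ K) μ := fun k =>
    Integrable.of_bound ((hm k).norm.inf aestronglyMeasurable_const) K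
      (Eventually.of_forall fun y => by
        rw [Real.norm_eq_abs, abs_of_nonneg (le_min (norm_nonneg _) hK)]
        exact min_le_right _ _)
  -- Truncation at `K`: the truncated part converges by dominated convergence, and the excess over
  -- `K` is at most `f k`.
  have hb : ∀ k, ∀ᵐ y ∂μ, ‖h k y‖ ≤ min ‖h k y‖ K + f k y := fun k => by
    filter_upwards [hle k] with y hy
    rcases le_total ‖h k y‖ K with h1 | h1
    · rw [min_eq_left h1]; linarith [hnn k y]
    · rwa [min_eq_right h1]
  have hhi : ∀ k, Integrable (h k) μ := fun k =>
    ((hmini k).add (hf k)).mono' (hm k) (hb k)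
  have hnorm : Tendsto (fun k => ∫ y, ‖h k y‖ ∂μ) atTop (𝓝 0) := by
    have hsum := hmin.add hf0
    rw [add_zero] at hsum
    refine squeeze_zero (fun k => integral_nonneg fun _ => norm_nonneg _) (fun k => ?_) hsum
    rw [← integral_add (hmini k) (hf k)]
    exact integral_mono_ae (hhi k).norm ((hmini k).add (hf k)) (hb k)
  have := ENNReal.tendsto_ofReal hnorm
  rw [ENNReal.ofReal_zero] at this
  refine this.congr fun k => ?_
  rw [ofReal_integral_norm_eq_lintegral_enorm (hhi k), eLpNorm_one_eq_lintegral_enorm]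

/-! ### Extraction of a subsequence approaching the zeros of the potential. -/

theorem IsMinimiser.tendsto_integral_bulkNonneg {c : ℝ} (hc : 0 < c) {l : ℕ → ℝ}
    (hl : ∀ n, 0 < l n) (hl0 : Tendsto l atTop (𝓝 0)) {p : ℕ → AdmissibleMap}
    (hp : ∀ n, IsMinimiser c (l n) (p n)) :
    Tendsto (fun n => ∫ y in Ioo (-1 : ℝ) 1, bulkNonneg c ((p n).toFun y)) atTop (𝓝 0) := by
  have hlim : Tendsto (fun n => Real.sqrt (l n) *
      (Real.sqrt 2 * boundaryCost c (well c true) + 1)) atTop (𝓝 0) := by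
    have := (((Real.continuous_sqrt.tendsto 0).comp hl0).mul_const
      (Real.sqrt 2 * boundaryCost c (well c true) + 1))
    simpa using this
  refine squeeze_zero' (Eventually.of_forall fun n =>
    integral_nonneg fun _ => bulkNonneg_nonneg hc _) ?_ hlim
  filter_upwards [IsMinimiser.eventually_energy_le hc hl hl0 hp true one_pos] with n hn
  exact ((p n).integral_bulkNonneg_le (hl n)).trans
    (mul_le_mul_of_nonneg_left hn (Real.sqrt_nonneg _))

/-- For a non-negative potential, vanishing integrals mean convergence in `L¹`, hence in measure,
hence almost everywhere along a subsequence. -/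
theorem exists_subseq_ae_tendsto_bulkNonneg {c : ℝ} (hc : 0 < c) {p : ℕ → AdmissibleMap}
    (h : Tendsto (fun n => ∫ y in Ioo (-1 : ℝ) 1, bulkNonneg c ((p n).toFun y)) atTop (𝓝 0)) :
    ∃ φ : ℕ → ℕ, StrictMono φ ∧ ∀ᵐ y ∂(volume.restrict (Ioo (-1 : ℝ) 1)),
      Tendsto (fun k => bulkNonneg c ((p (φ k)).toFun y)) atTop (𝓝 0) := by
  have hi := fun n => (p n).integrableOn_bulkNonneg c
  refine (tendstoInMeasure_of_tendsto_eLpNorm (g := fun _ => (0 : ℝ)) one_ne_zero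
    (fun n => (hi n).aestronglyMeasurable) aestronglyMeasurable_const ?_).exists_seq_tendsto_ae
  have := ENNReal.tendsto_ofReal h
  rw [ENNReal.ofReal_zero] at this
  refine this.congr fun n => ?_
  rw [eLpNorm_one_eq_lintegral_enorm, ofReal_integral_eq_lintegral_ofReal (hi n)
    (Eventually.of_forall fun _ => bulkNonneg_nonneg hc _)]
  refine lintegral_congr fun y => ?_
  simp [Real.enorm_eq_ofReal (bulkNonneg_nonneg hc _)]

/-- Which well is selected by the sign of the second coordinate. -/
def wellIndex (p : Plane) : Bool := decide (0 ≤ p 1)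

theorem tendsto_well_of_tendsto_bulkNonneg {c : ℝ} (hc : 0 < c) {ℱ : Filter ℕ} {u : ℕ → Plane}
    (h : Tendsto (fun k => bulkNonneg c (u k)) ℱ (𝓝 0)) {i : Bool}
    (hi : ∀ᶠ k in ℱ, wellIndex (u k) = i) : Tendsto u ℱ (𝓝 (well c i)) := by
  obtain ⟨K, -, hK⟩ := exists_norm_sub_sq_le hc
  rw [tendsto_iff_norm_sub_tendsto_zero]
  have h1 : Tendsto (fun k => Real.sqrt (K * bulkNonneg c (u k))) ℱ (𝓝 0) := by
    have := (h.const_mul K).sqrt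
    simpa using this
  refine squeeze_zero' (Eventually.of_forall fun _ => norm_nonneg _) ?_ h1
  filter_upwards [hi] with k hk
  refine Real.le_sqrt_of_sq_le ?_
  cases i
  · have : ¬ 0 ≤ u k 1 := by simpa [wellIndex] using hk
    exact (hK (u k)).2 (not_le.1 this).le
  · have : 0 ≤ u k 1 := by simpa [wellIndex] using hk
    exact (hK (u k)).1 this

/-- Diagonal extraction on a countable set of points. -/
theorem exists_subseq_eventually_eq {D : Set ℝ} (hD : D.Countable) (s : ℕ → ℝ → Bool) :
    ∃ (σ : ℝ → Bool) (ψ : ℕ → ℕ), StrictMono ψ ∧ ∀ y ∈ D, ∀ᶠ k in atTop, s (ψ k) y = σ y := by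
  classical
  have := hD.to_subtype
  -- For countable `D` the product of copies of `Bool` over `D` is compact and metrisable, hence
  -- sequentially compact.
  obtain ⟨a, ψ, hψ, ha⟩ := CompactSpace.tendsto_subseq fun k (y : D) => s k y
  refine ⟨fun y => if h : y ∈ D then a ⟨y, h⟩ else true, ψ, hψ, fun y hy => ?_⟩
  have h1 := (tendsto_pi_nhds.1 ha) ⟨y, hy⟩
  rw [nhds_discrete, tendsto_pure] at h1
  filter_upwards [h1] with k hk
  simp only [dif_pos hy]
  exact hk

/-- A set of full measure meets every subinterval, and a countable dense subset of it inherits this.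
Diagonal extraction requires such a countable set. -/
theorem exists_countable_subset_of_ae {G : Set ℝ}
    (hae : ∀ᵐ y ∂(volume.restrict (Ioo (-1 : ℝ) 1)), y ∈ G) :
    ∃ D ⊆ G, D.Countable ∧ ∀ x y : ℝ, -1 ≤ x → x < y → y ≤ 1 → ∃ z ∈ D, x < z ∧ z < y := by
  obtain ⟨D, hDG, hDc, hcl⟩ :=
    (TopologicalSpace.IsSeparable.of_separableSpace G).exists_countable_dense_subset
  refine ⟨D, hDG, hDc, fun x y hx hxy hy => ?_⟩
  have hsub : Ioo x y ⊆ Ioo (-1 : ℝ) 1 := Ioo_subset_Ioo hx hy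
  have hae' : ∀ᵐ z ∂(volume.restrict (Ioo x y)), z ∈ G :=
    ae_mono (Measure.restrict_mono hsub le_rfl) hae
  obtain ⟨g, hg, hgxy⟩ : ∃ g ∈ G, g ∈ Ioo x y := by
    have hne : (ae (volume.restrict (Ioo x y))).NeBot := by
      rw [ae_neBot, Ne, Measure.restrict_eq_zero, Real.volume_Ioo]
      simpa using hxy
    exact (hae'.and (ae_restrict_mem measurableSet_Ioo)).exists
  obtain ⟨z, hz, hzD⟩ := mem_closure_iff.1 (hcl hg) (Ioo x y) isOpen_Ioo hgxy
  exact ⟨z, hzD, hz⟩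

end Ferronematic

end

/-! ### Proof of the theorem. -/

open Ferronematic in
theorem theorem3p2 (c : ℝ) (hc : 0 < c) (l : ℕ → ℝ) (hl : ∀ n, 0 < l n)
    (hl0 : Filter.Tendsto l Filter.atTop (nhds 0))
    (p : ℕ → Ferronematic.AdmissibleMap)
    (hp : ∀ n, Ferronematic.IsMinimiser c (l n) (p n)) :
    ∃ φ : ℕ → ℕ, StrictMono φ ∧ ∃ P : Ferronematic.TwoPhasePartition c,
      Filter.Tendsto
        (fun k => MeasureTheory.eLpNorm (fun y => (p (φ k)).toFun y - P.map y) 1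
          (MeasureTheory.volume.restrict (Set.Icc (-1 : ℝ) 1)))
        Filter.atTop (nhds 0) ∧
      (∀ᵐ y ∂(MeasureTheory.volume.restrict (Set.Icc (-1 : ℝ) 1)),
        Filter.Tendsto (fun k => (p (φ k)).toFun y) Filter.atTop (nhds (P.map y))) ∧
      ∀ P' : Ferronematic.TwoPhasePartition c, P.J ≤ P'.J := by
  have hF := IsMinimiser.tendsto_integral_bulkNonneg hc hl hl0 hp
  obtain ⟨φ₁, hφ₁, hae⟩ := exists_subseq_ae_tendsto_bulkNonneg hc hF
  set G : Set ℝ := {y | y ∈ Ioo (-1 : ℝ) 1 ∧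
    Tendsto (fun k => bulkNonneg c ((p (φ₁ k)).toFun y)) atTop (𝓝 0)} with hG
  have hGI : G ⊆ Ioo (-1) 1 := fun y hy => hy.1
  have hGae : ∀ᵐ y ∂(volume.restrict (Ioo (-1 : ℝ) 1)), y ∈ G := by
    filter_upwards [hae, ae_restrict_mem measurableSet_Ioo] with y h1 h2 using ⟨h2, h1⟩
  obtain ⟨D, hDG, hDc, hdense⟩ := exists_countable_subset_of_ae hGae
  obtain ⟨σ, φ₂, hφ₂, hσ⟩ := exists_subseq_eventually_eq hDc
    fun k y => wellIndex ((p (φ₁ k)).toFun y)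
  set φ : ℕ → ℕ := φ₁ ∘ φ₂ with hφ
  have hφm : StrictMono φ := hφ₁.comp hφ₂
  have hGlim : ∀ y ∈ G, Tendsto (fun k => bulkNonneg c ((p (φ k)).toFun y)) atTop (𝓝 0) :=
    fun y hy => hy.2.comp hφ₂.tendsto_atTop
  have hE : ∀ i, ∀ ε > 0, ∀ᶠ k in atTop, energy c (l (φ k)) (p (φ k)) ≤
      Real.sqrt 2 * boundaryCost c (well c i) + ε := fun i ε hε =>
    hφm.tendsto_atTop.eventually (IsMinimiser.eventually_energy_le hc hl hl0 hp i hε)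
  -- The pattern is excluded even when it only recurs infinitely often: at points of `G` outside `D`
  -- the index is not known to stabilise. The lower bound is applied along `atTop` restricted to the
  -- indices where the pattern occurs, and two crossings contradict the upper bound for the constant
  -- well `i`.
  have hno : ∀ x ∈ G, ∀ y ∈ G, ∀ z ∈ G, x < y → y < z → ∀ i,
      ¬ ∃ᶠ k in atTop, wellIndex ((p (φ k)).toFun x) = i ∧
        wellIndex ((p (φ k)).toFun y) = !i ∧ wellIndex ((p (φ k)).toFun z) = i := by
    intro x hx y hy z hz hxy hyz i hfreq
    set S : Set ℕ := {k | wellIndex ((p (φ k)).toFun x) = i ∧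
      wellIndex ((p (φ k)).toFun y) = !i ∧ wellIndex ((p (φ k)).toFun z) = i} with hS
    have hne : (atTop ⊓ 𝓟 S).NeBot := frequently_mem_iff_neBot.1 hfreq
    have hle : atTop ⊓ 𝓟 S ≤ (atTop : Filter ℕ) := inf_le_left
    have hSev : ∀ᶠ k in atTop ⊓ 𝓟 S, k ∈ S := mem_inf_of_right (mem_principal_self S)
    have key := geoDist_add_le_boundaryCost hc (fun k => hl (φ k)) (q := fun k => p (φ k))
      (fun ε hε => hle (hE i ε hε)) hx.1.1.le hxy.le hyz.le hz.1.2.le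
      (tendsto_well_of_tendsto_bulkNonneg hc ((hGlim x hx).mono_left hle) (hSev.mono fun k h => h.1))
      (tendsto_well_of_tendsto_bulkNonneg hc ((hGlim y hy).mono_left hle) (hSev.mono fun k h => h.2.1))
      (tendsto_well_of_tendsto_bulkNonneg hc ((hGlim z hz).mono_left hle) (hSev.mono fun k h => h.2.2))
    rw [geoDist_well_of_ne c (by simp), geoDist_well_of_ne c (by simp), boundaryCost] at key
    linarith [geoDist_pStar_pStarStar_pos hc]
  have hnotnot : ∀ {a b : Bool}, a ≠ b → a = !b := by decide
  obtain ⟨t, ht, i, j, hti, htj⟩ := exists_switch_of_no_alternation (hDG.trans hGI) σ (by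
    intro x hx y hy z hz hxy hyz hxz
    by_contra hne
    refine hno x (hDG hx) y (hDG hy) z (hDG hz) hxy hyz (σ x) (Eventually.frequently ?_)
    filter_upwards [hσ x hx, hσ y hy, hσ z hz] with k h1 h2 h3
    exact ⟨h1, h2.trans (hnotnot hne), h3.trans hxz.symm⟩)
  obtain ⟨P, hPmap, hPJ⟩ := exists_twoPhasePartition hc ht i j
  -- Enclose `y` between two points of `D` where the index is eventually `i`. If the index at `y`
  -- differed from `i` infinitely often, the excluded pattern would recur.
  have side : ∀ y ∈ G, ∀ a b : ℝ, -1 ≤ a → a < y → y < b → b ≤ 1 → ∀ i,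
      (∀ z ∈ D, a < z → z < b → σ z = i) →
      Tendsto (fun k => (p (φ k)).toFun y) atTop (𝓝 (well c i)) := by
    intro y hy a b ha hay hyb hb i hi
    refine tendsto_well_of_tendsto_bulkNonneg hc (hGlim y hy) ?_
    obtain ⟨x, hx, hax, hxy⟩ := hdense a y ha hay hy.1.2.le
    obtain ⟨z, hz, hyz, hzb⟩ := hdense y b hy.1.1.le hyb hb
    by_contra hnot
    have hfreq : ∃ᶠ k in atTop, wellIndex ((p (φ k)).toFun y) ≠ i :=
      not_eventually.1 hnot
    refine hno x (hDG hx) y hy z (hDG hz) hxy hyz i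
      ((hfreq.and_eventually ((hσ x hx).and (hσ z hz))).mono ?_)
    rintro k ⟨h1, h2, h3⟩
    exact ⟨h2.trans (hi x hx hax (hxy.trans hyb)), hnotnot h1,
      h3.trans (hi z hz (hay.trans hyz) hzb)⟩
  have hlim : ∀ y ∈ G, y ≠ t → Tendsto (fun k => (p (φ k)).toFun y) atTop (𝓝 (P.map y)) := by
    intro y hy hyt
    rw [hPmap y hy.1 hyt]
    split_ifs with h
    · exact side y hy (-1) t le_rfl hy.1.1 h ht.2.le i fun z hz _ hzt => hti z hz hzt
    · exact side y hy t 1 ht.1.le (lt_of_le_of_ne (not_lt.1 h) hyt.symm) hy.1.2 le_rfl j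
        fun z hz htz _ => htj z hz htz
  have hnet : ∀ᵐ y ∂(volume.restrict (Ioo (-1 : ℝ) 1)), y ≠ t :=
    ae_restrict_of_ae (Measure.ae_ne volume t)
  have hIcc : volume.restrict (Icc (-1 : ℝ) 1) = volume.restrict (Ioo (-1 : ℝ) 1) :=
    (Measure.restrict_congr_set Ioo_ae_eq_Icc).symm
  have haelim : ∀ᵐ y ∂(volume.restrict (Ioo (-1 : ℝ) 1)),
      Tendsto (fun k => (p (φ k)).toFun y) atTop (𝓝 (P.map y)) := by
    filter_upwards [hGae, hnet] with y h1 h2 using hlim y h1 h2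
  refine ⟨φ, hφm, P, ?_, by rwa [hIcc], fun P' => ?_⟩
  · rw [hIcc]
    obtain ⟨K, hK, hKb⟩ := exists_norm_le_bulkNonneg hc
    have hint : ∀ k, Integrable (fun y => K * bulkNonneg c ((p (φ k)).toFun y))
        (volume.restrict (Ioo (-1 : ℝ) 1)) := fun k =>
      ((p (φ k)).integrableOn_bulkNonneg c).const_mul K
    have hmeas : AEStronglyMeasurable P.map (volume.restrict (Ioo (-1 : ℝ) 1)) := by
      have hm : Measurable fun y : ℝ => if y < t then well c i else well c j :=
        Measurable.ite measurableSet_Iio measurable_const measurable_const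
      refine hm.aestronglyMeasurable.congr ?_
      filter_upwards [ae_restrict_mem measurableSet_Ioo, hnet] with y h1 h2
      exact (hPmap y h1 h2).symm
    have hwell : ∀ i, ‖well c i‖ ≤ K := fun i => by
      have := hKb (well c i)
      rwa [bulkNonneg_well hc, mul_zero, add_zero] at this
    refine tendsto_eLpNorm_one_of_norm_le (K := K + K)
      (f := fun k y => K * bulkNonneg c ((p (φ k)).toFun y)) (by positivity)
      (fun k => ((p (φ k)).memLp.1).sub hmeas) hint ?_ (fun k => ?_)
      (fun k y => mul_nonneg hK.le (bulkNonneg_nonneg hc _)) ?_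
    · simp_rw [integral_const_mul]
      simpa using (hF.comp hφm.tendsto_atTop).const_mul K
    · filter_upwards [ae_restrict_mem measurableSet_Ioo, hnet] with y h1 h2
      have h3 : ‖P.map y‖ ≤ K := by
        rw [hPmap y h1 h2]; split_ifs <;> exact hwell _
      linarith [norm_sub_le ((p (φ k)).toFun y) (P.map y), hKb ((p (φ k)).toFun y)]
    · filter_upwards [haelim] with y hy
      simpa using hy.sub_const (P.map y)
  -- One point on each side of `t` sees both values of the limit. The lower bound there, with the
  -- last point repeated, is compared with the constant competitor equal to the first value of `P'`,
  -- whose cost is at most `P'.J`.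
  · obtain ⟨x, hx, -, hxt⟩ := hdense (-1) t le_rfl ht.1 ht.2.le
    obtain ⟨z, hz, htz, -⟩ := hdense t 1 ht.1.le ht.2 le_rfl
    obtain ⟨i', hi'⟩ : ∃ i', P'.value 0 = well c i' := by
      rcases P'.value_mem 0 with h | h
      · exact ⟨true, h⟩
      · exact ⟨false, h⟩
    have tx := hlim x (hDG hx) hxt.ne
    have tz := hlim z (hDG hz) htz.ne'
    rw [hPmap x (hDG hx).1 hxt.ne, if_pos hxt] at tx
    rw [hPmap z (hDG hz).1 htz.ne', if_neg htz.not_gt] at tz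
    have key := geoDist_add_le_boundaryCost hc (fun k => hl (φ k)) (q := fun k => p (φ k))
      (hE i') (hDG hx).1.1.le (hxt.trans htz).le le_rfl (hDG hz).1.2.le tx tz tz
    have h1 := boundaryCost_value_le_J P'
    rw [hi'] at h1
    linarith [geoDist_nonneg c (well c j) (well c j)]
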